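/- Let $k$ be a commutative ring and let $A = A_{\bar 0}\oplus A_{\bar 1}$ be a symmetric Frobenius superalgebra over $k$ with trace map of parity $\sigma\in\mathbb Z/2$: there are a homogeneous $k$-linear map $\operatorname{tr}\colon A\to k$ of parity $\sigma$ with $\operatorname{tr}(ab)=(-1)^{\bar a\bar b}\operatorname{tr}(ba)$, and a finite homogeneous basis $B$ of $A$ with a dual basis $\{b^\vee : b\in B\}$, so that $\operatorname{tr}(a^\vee b)=\delta_{a,b}$ for $a,b\in B$. Put $\tau=\sum_{b\in B}(-1)^{\sigma\bar b}\,b\otimes b^\vee\in A^{\otimes 2}$. Let $\mathcal{NH}(A)$ be the strict $k$-linear monoidal supercategory (with super interchange law $(f'\otimes g)\circ(f\otimes g')=(-1)^{\bar f\bar g}(f'\circ f)\otimes(g\circ g')$) with one generating object $\star$, generating morphisms an even crossing $X\in\operatorname{End}(\star^{\otimes 2})$, a dot $d\in\operatorname{End}(\star)$ of parity $\sigma$, and tokens $t_a\in\operatorname{End}(\star)$ of parity $\bar a$ for homogeneous $a \in A$ (extended linearly to all $a\in A$), subject to the relations: $a\mapsto t_a$ is linear, $t_1=1_\star$ and $t_a\circ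 t_b=t_{ab}$; $$X\circ X=0,\qquad (X\otimes 1_\star)(1_\star\otimes X)(X\otimes 1_\star)=(1_\star\otimes X)(X\otimes 1_\star)(1_\star\otimes X),$$ $$X(t_a\otimes 1_\star)=(1_\star\otimes t_a)X,\qquad X(1_\star\otimes t_a)=(t_a\otimes 1_\star)X,\qquad t_a d=(-1)^{\sigma\bar a}\,d\,t_a,$$ $$X(d\otimes 1_\star)-(1_\star\otimes d)X=T,\qquad (d\otimes 1_\star)X-X(1_\star\otimes d)=(-1)^\sigma T,\qquad T:=\sum_{b\in B}(-1)^{\sigma\bar b}\,t_b\otimes t_{b^\vee}.$$ For $n\ge 0$ let $NH_n(A):=\operatorname{End}_{\mathcal{NH}(A)}(\star^{\otimes n})$. Factors of $A^{\otimes n}$ and strands are numbered from right to left. The multiplication of $A^{\otimes n}$ is that of the tensor product of superalgebras, $(a'\otimes b)(a\otimes b')=(-1)^{\bar a\bar b}a'a\otimes bb'$; the simple transposition $s_i$ acts on it by exchanging the factors $a_i$ and $a_{i+1}$ with the sign $(-1)^{\bar a_i\bar a_{i+1}}$; and $\tau_i:=1^{\otimes(n-i-1)}\otimes\tau\otimes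 1^{\otimes(i-1)}$. **Proposition.** As a superalgebra, $NH_n(A)$ is isomorphic to the free product of $A^{\otimes n}$ and the free associative superalgebra on even generators $u_1,\dots,u_{n-1}$ and generators $x_1,\dots,x_n$ of parity $\sigma$, subject to the relations \begin{align*} u_i^2&=0, & 1\le i\le n-1,\\ u_iu_j&=u_ju_i, & |i-j|>1,\\ u_iu_{i+1}u_i&=u_{i+1}u_iu_{i+1}, & 1\le i\le n-2,\\ u_i\mathbf a&=s_i(\mathbf a)u_i, & 1\le i\le n-1,\ \mathbf a\in A^{\otimes n},\\ x_ix_j&=(-1)^\sigma x_jx_i, & i\ne j,\\ \mathbf a x_i&=(-1)^{\sigma\bar{\mathbf a}}x_i\mathbf a, & 1\le i\le n,\ \mathbf a\in A^{\otimes n}\text{ homogeneous},\\ x_ju_i&=u_ix_j, & j\notin\{i,i+1\},\\ u_ix_{i+1}&=x_iu_i+\tau_i, & 1\le i\le n-1,\\ x_{i+1}u_i&=u_ix_i+(-1)^\sigma\tau_i, & 1\le i\le n-1. \end{align*} The isomorphism preserves parity and can be chosen so that $u_i$ corresponds to the crossing of the strands $i$ and $i+1$, $x_j$ to the dot on strand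 $j$, and $1^{\otimes(n-j)}\otimes a\otimes 1^{\otimes(j-1)}$ to the token $t_a$ on strand $j$. -/

import Mathlib

open scoped DirectSum TensorProduct

noncomputable section

namespace FrobeniusNilHecke

universe u v w

/-- The sign `(-1)^p` in a commutative ring, for a parity `p` in `ℤ/2`. -/
def sgn (k : Type u) [CommRing k] (p : ZMod 2) : k := if p = 0 then 1 else -1

lemma zmod2_cases (p : ZMod 2) : p = 0 ∨ p = 1 := by
  revert p; decide

lemma sgn_zero (k : Type u) [CommRing k] : sgn k 0 = 1 := by simp [sgn]

lemma sgn_one (k : Type u) [CommRing k] : sgn k 1 = -1 := by simp [sgn]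

lemma sgn_add (k : Type u) [CommRing k] (p q : ZMod 2) : sgn k (p + q) = sgn k p * sgn k q := by
  rcases zmod2_cases p with rfl | rfl <;> rcases zmod2_cases q with rfl | rfl
  · simp [sgn_zero]
  · simp [sgn_zero]
  · simp [sgn_zero]
  · rw [show (1 + 1 : ZMod 2) = 0 from by decide, sgn_zero, sgn_one]; ring

/-! ### Tensor powers of a superalgebra

A superalgebra is a `k`-algebra `A` with a `ℤ/2`-grading `𝒜`. -/

section SuperTensorPower

variable {k : Type u} [CommRing k] {A : Type v} [Ring A] [Algebra k A]

/-- The `k`-module `A^{⊗n}`. Tensor factors are numbered from right to left: the index `i : Fin n`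
is the `(i+1)`-st factor from the right, so `tprod a` is
`a (n-1) ⊗ ⋯ ⊗ a 1 ⊗ a 0`. -/
def SuperTensorPower (_𝒜 : ZMod 2 → Submodule k A) (n : ℕ) : Type (max u v) :=
  ⨂[k] _ : Fin n, A

variable (𝒜 : ZMod 2 → Submodule k A)

instance (n : ℕ) : AddCommGroup (SuperTensorPower 𝒜 n) :=
  inferInstanceAs (AddCommGroup (⨂[k] _ : Fin n, A))

instance (n : ℕ) : Module k (SuperTensorPower 𝒜 n) :=
  inferInstanceAs (Module k (⨂[k] _ : Fin n, A))

/-- The pure tensor `a (n-1) ⊗ ⋯ ⊗ a 1 ⊗ a 0`. -/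
def SuperTensorPower.tprod {n : ℕ} (a : Fin n → A) : SuperTensorPower 𝒜 n :=
  PiTensorProduct.tprod k a

/-- The part of parity `p` of `A^{⊗n}`: the span of the pure tensors of homogeneous elements whose
parities add up to `p`. -/
def SuperTensorPower.parity (n : ℕ) (p : ZMod 2) : Submodule k (SuperTensorPower 𝒜 n) :=
  Submodule.span k {x | ∃ (q : Fin n → ZMod 2) (a : Fin n → A),
    (∀ i, a i ∈ 𝒜 (q i)) ∧ ∑ i, q i = p ∧ x = SuperTensorPower.tprod 𝒜 a}

variable [GradedAlgebra 𝒜]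

/-- The projection of `A^{⊗n}` onto its summand `𝒜 (p (n-1)) ⊗ ⋯ ⊗ 𝒜 (p 0)`. -/
def multiProj (n : ℕ) (p : Fin n → ZMod 2) : (⨂[k] _ : Fin n, A) →ₗ[k] (⨂[k] _ : Fin n, A) :=
  PiTensorProduct.map (fun i => GradedAlgebra.proj 𝒜 (p i))

/-- The sign `∏_{i<j} (-1)^{p i * q j}` from moving the entries of a second tensor past those of
the first one. Here `b j` passes `a i` exactly if the factor `i` is to the right of the
factor `j`, that is, if `i < j`. -/
def koszulSign (k : Type u) [CommRing k] {n : ℕ} (p q : Fin n → ZMod 2) : k :=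
  sgn k (∑ i, ∑ j, if i < j then p i * q j else 0)

/-- The multiplication of `A^{⊗n}`: for homogeneous entries,
`(⊗ a i) * (⊗ b i) = ∏_{i<j} (-1)^{|a i| |b j|} • ⊗ (a i * b i)`.
The products on the right are those of Mathlib's (unsigned) tensor product of algebras. -/
def superMul (n : ℕ) :
    (⨂[k] _ : Fin n, A) →ₗ[k] (⨂[k] _ : Fin n, A) →ₗ[k] (⨂[k] _ : Fin n, A) :=
  ∑ p : Fin n → ZMod 2, ∑ q : Fin n → ZMod 2, koszulSign k p q •
    (LinearMap.mul k (⨂[k] _ : Fin n, A)).compl₁₂ (multiProj 𝒜 n p) (multiProj 𝒜 n q)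

lemma proj_proj (p q : ZMod 2) (a : A) :
    GradedAlgebra.proj 𝒜 p (GradedAlgebra.proj 𝒜 q a) =
      if p = q then GradedAlgebra.proj 𝒜 q a else 0 := by
  simp only [GradedAlgebra.proj_apply]
  split_ifs with h
  · subst h; exact DirectSum.decompose_of_mem_same 𝒜 (SetLike.coe_mem _)
  · exact DirectSum.decompose_of_mem_ne 𝒜 (SetLike.coe_mem _) (Ne.symm h)

lemma proj_mul (r p q : ZMod 2) (a b : A) :
    GradedAlgebra.proj 𝒜 r (GradedAlgebra.proj 𝒜 p a * GradedAlgebra.proj 𝒜 q b) =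
      if r = p + q then GradedAlgebra.proj 𝒜 p a * GradedAlgebra.proj 𝒜 q b else 0 := by
  have hm : GradedAlgebra.proj 𝒜 p a * GradedAlgebra.proj 𝒜 q b ∈ 𝒜 (p + q) := by
    simp only [GradedAlgebra.proj_apply]
    exact SetLike.mul_mem_graded (SetLike.coe_mem _) (SetLike.coe_mem _)
  rw [GradedAlgebra.proj_apply 𝒜 r]
  split_ifs with h
  · subst h; exact DirectSum.decompose_of_mem_same 𝒜 hm
  · exact DirectSum.decompose_of_mem_ne 𝒜 hm (Ne.symm h)

lemma sum_proj (a : A) : ∑ p : ZMod 2, GradedAlgebra.proj 𝒜 p a = a := by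
  classical
  conv_rhs => rw [← DirectSum.sum_support_decompose 𝒜 a]
  simp only [GradedAlgebra.proj_apply]
  symm
  apply Finset.sum_subset (Finset.subset_univ _)
  intro p _ hp
  simpa using hp

lemma multiProj_tprod (n : ℕ) (p : Fin n → ZMod 2) (a : Fin n → A) :
    multiProj 𝒜 n p (PiTensorProduct.tprod k a) =
      PiTensorProduct.tprod k (fun i => GradedAlgebra.proj 𝒜 (p i) (a i)) :=
  PiTensorProduct.map_tprod _ _

lemma sum_multiProj (n : ℕ) (x : ⨂[k] _ : Fin n, A) : ∑ p, multiProj 𝒜 n p x = x := by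
  induction x using PiTensorProduct.induction_on with
  | smul_tprod r a =>
    simp only [map_smul, multiProj_tprod, ← Finset.smul_sum]
    rw [← MultilinearMap.map_sum (PiTensorProduct.tprod k)
      (fun i p => GradedAlgebra.proj 𝒜 p (a i))]
    simp only [sum_proj]
  | add x y hx hy => simp only [map_add, Finset.sum_add_distrib, hx, hy]

lemma multiProj_mul (n : ℕ) (r p q : Fin n → ZMod 2) (x y : ⨂[k] _ : Fin n, A) :
    multiProj 𝒜 n r (multiProj 𝒜 n p x * multiProj 𝒜 n q y) =
      if r = p + q then multiProj 𝒜 n p x * multiProj 𝒜 n q y else 0 := by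
  induction x using PiTensorProduct.induction_on with
  | smul_tprod c a =>
    induction y using PiTensorProduct.induction_on with
    | smul_tprod d b =>
      simp only [map_smul, multiProj_tprod, smul_mul_assoc, mul_smul_comm,
        PiTensorProduct.tprod_mul_tprod]
      split_ifs with h
      · subst h
        congr 3
        ext i
        exact (proj_mul 𝒜 _ _ _ _ _).trans (if_pos rfl)
      · obtain ⟨i, hi⟩ := Function.ne_iff.mp h
        rw [(PiTensorProduct.tprod k).map_coord_zero i, smul_zero, smul_zero]
        exact (proj_mul 𝒜 _ _ _ _ _).trans (if_neg hi)
    | add y z hy hz => 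
      simp only [map_add, mul_add, hy, hz]
      split_ifs <;> simp
  | add x z hx hz =>
      simp only [map_add, add_mul, hx, hz]
      split_ifs <;> simp

lemma multiProj_one (n : ℕ) (p : Fin n → ZMod 2) :
    multiProj 𝒜 n p 1 = if p = 0 then 1 else 0 := by
  rw [PiTensorProduct.one_def, multiProj_tprod]
  split_ifs with h
  · subst h
    congr 1
    ext i
    exact DirectSum.decompose_of_mem_same 𝒜 (SetLike.GradedOne.one_mem (A := 𝒜))
  · obtain ⟨i, hi⟩ := Function.ne_iff.mp h
    rw [(PiTensorProduct.tprod k).map_coord_zero i]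
    exact DirectSum.decompose_of_mem_ne 𝒜 (SetLike.GradedOne.one_mem (A := 𝒜)) (Ne.symm hi)

lemma koszulSign_add_left {n : ℕ} (p q r : Fin n → ZMod 2) :
    koszulSign k (p + q) r = koszulSign k p r * koszulSign k q r := by
  simp only [koszulSign, ← sgn_add, ← Finset.sum_add_distrib]
  congr 1
  refine Finset.sum_congr rfl fun i _ => Finset.sum_congr rfl fun j _ => ?_
  split_ifs <;> simp [add_mul]

lemma koszulSign_add_right {n : ℕ} (p q r : Fin n → ZMod 2) :
    koszulSign k p (q + r) = koszulSign k p q * koszulSign k p r := by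
  simp only [koszulSign, ← sgn_add, ← Finset.sum_add_distrib]
  congr 1
  refine Finset.sum_congr rfl fun i _ => Finset.sum_congr rfl fun j _ => ?_
  split_ifs <;> simp [mul_add]

lemma koszulSign_zero_left {n : ℕ} (p : Fin n → ZMod 2) : koszulSign k 0 p = 1 := by
  simp [koszulSign, sgn_zero]

lemma koszulSign_zero_right {n : ℕ} (p : Fin n → ZMod 2) : koszulSign k p 0 = 1 := by
  simp [koszulSign, sgn_zero]

lemma superMul_apply (n : ℕ) (x y : ⨂[k] _ : Fin n, A) :
    superMul 𝒜 n x y =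
      ∑ p, ∑ q, koszulSign k p q • (multiProj 𝒜 n p x * multiProj 𝒜 n q y) := by
  simp [superMul, LinearMap.sum_apply]

lemma superMul_assoc (n : ℕ) (x y z : ⨂[k] _ : Fin n, A) :
    superMul 𝒜 n (superMul 𝒜 n x y) z = superMul 𝒜 n x (superMul 𝒜 n y z) := by
  have h1 : superMul 𝒜 n (superMul 𝒜 n x y) z =
      ∑ s, ∑ p, ∑ q, (koszulSign k (p + q) s * koszulSign k p q) •
        (multiProj 𝒜 n p x * multiProj 𝒜 n q y * multiProj 𝒜 n s z) := by
    rw [superMul_apply, Finset.sum_comm]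
    refine Finset.sum_congr rfl fun s _ => ?_
    simp only [superMul_apply, map_sum, map_smul, multiProj_mul, Finset.sum_mul,
      Finset.smul_sum, smul_mul_assoc, smul_smul]
    rw [Finset.sum_comm]
    refine Finset.sum_congr rfl fun p _ => ?_
    rw [Finset.sum_comm]
    refine Finset.sum_congr rfl fun q _ => ?_
    simp [ite_mul]
  have h2 : superMul 𝒜 n x (superMul 𝒜 n y z) =
      ∑ p, ∑ q, ∑ s, (koszulSign k p (q + s) * koszulSign k q s) •
        (multiProj 𝒜 n p x * (multiProj 𝒜 n q y * multiProj 𝒜 n s z)) := by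
    rw [superMul_apply]
    refine Finset.sum_congr rfl fun p _ => ?_
    simp only [superMul_apply, map_sum, map_smul, multiProj_mul, Finset.mul_sum,
      Finset.smul_sum, mul_smul_comm, smul_smul]
    rw [Finset.sum_comm]
    refine Finset.sum_congr rfl fun q _ => ?_
    rw [Finset.sum_comm]
    refine Finset.sum_congr rfl fun s _ => ?_
    simp [mul_ite]
  rw [h1, h2, Finset.sum_comm]
  refine Finset.sum_congr rfl fun p _ => ?_
  rw [Finset.sum_comm]
  refine Finset.sum_congr rfl fun q _ => Finset.sum_congr rfl fun s _ => ?_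
  rw [koszulSign_add_left, koszulSign_add_right, mul_assoc (multiProj 𝒜 n p x)]
  congr 1
  ring

lemma superMul_one_left (n : ℕ) (x : ⨂[k] _ : Fin n, A) : superMul 𝒜 n 1 x = x := by
  rw [superMul_apply, Finset.sum_comm]
  conv_rhs => rw [← sum_multiProj 𝒜 n x]
  refine Finset.sum_congr rfl fun q _ => ?_
  simp [multiProj_one, ite_mul, koszulSign_zero_left]

lemma superMul_one_right (n : ℕ) (x : ⨂[k] _ : Fin n, A) : superMul 𝒜 n x 1 = x := by
  rw [superMul_apply]
  conv_rhs => rw [← sum_multiProj 𝒜 n x]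
  refine Finset.sum_congr rfl fun q _ => ?_
  simp [multiProj_one, mul_ite, koszulSign_zero_right]

instance (n : ℕ) : Ring (SuperTensorPower 𝒜 n) :=
  { (inferInstance : AddCommGroup (SuperTensorPower 𝒜 n)) with
    mul := fun x y => superMul 𝒜 n x y
    one := (1 : ⨂[k] _ : Fin n, A)
    left_distrib := fun x y z => map_add (superMul 𝒜 n x) y z
    right_distrib := fun x y z => LinearMap.map_add₂ (superMul 𝒜 n) x y z
    zero_mul := fun x => LinearMap.map_zero₂ (superMul 𝒜 n) x
    mul_zero := fun x => map_zero (superMul 𝒜 n x)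
    mul_assoc := superMul_assoc 𝒜 n
    one_mul := superMul_one_left 𝒜 n
    mul_one := superMul_one_right 𝒜 n }

instance (n : ℕ) : Algebra k (SuperTensorPower 𝒜 n) :=
  Algebra.ofModule (fun r x y => LinearMap.map_smul₂ (superMul 𝒜 n) r x y)
    (fun r x y => map_smul (superMul 𝒜 n x) r y)

/-- The strands `i` and `i + 1` (counting from zero, from right to left) that meet in the `i`-th
crossing. -/
def lo {n : ℕ} (i : Fin (n - 1)) : Fin n := ⟨i, by omega⟩

/-- See `lo`. -/
def hi {n : ℕ} (i : Fin (n - 1)) : Fin n := ⟨i + 1, by omega⟩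

/-- The map that underlies `superSwap`: on the summand where the entries have parities `p`, exchange
the factors `lo i` and `hi i` and multiply by `(-1)^{p (lo i) p (hi i)}`. -/
def superSwapAux {n : ℕ} (i : Fin (n - 1)) : (⨂[k] _ : Fin n, A) →ₗ[k] (⨂[k] _ : Fin n, A) :=
  ∑ p : Fin n → ZMod 2, sgn k (p (lo i) * p (hi i)) •
    ((PiTensorProduct.reindex k (fun _ : Fin n => A) (Equiv.swap (lo i) (hi i))).toLinearMap ∘ₗ
      multiProj 𝒜 n p)

/-- The action on `A^{⊗n}` of the simple transposition of the factors `lo i` and `hi i` by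
superpermutations: on homogeneous pure tensors `⊗ a j` it exchanges these two factors and
multiplies by `(-1)^{|a (lo i)| |a (hi i)|}`. -/
def superSwap {n : ℕ} (i : Fin (n - 1)) (a : SuperTensorPower 𝒜 n) : SuperTensorPower 𝒜 n :=
  superSwapAux 𝒜 i a

end SuperTensorPower

/-! ### Symmetric Frobenius superalgebras -/

section Frobenius

variable {k : Type u} [CommRing k] {A : Type v} [Ring A] [Algebra k A]

/-- The structure of a symmetric Frobenius superalgebra on the superalgebra `A = 𝒜 0 ⊕ 𝒜 1`: a
homogeneous supersymmetric trace map `tr : A → k` of parity `σ`, and a finite homogeneous basis `b`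
of `A` that has a dual basis `b^∨`, so that `tr (b i ^∨ * b j) = δ i j`. -/
structure SymmetricFrobenius (𝒜 : ZMod 2 → Submodule k A) (ι : Type w) [Fintype ι]
    [DecidableEq ι] where
  /-- the parity of the trace map -/
  σ : ZMod 2
  /-- the trace map -/
  tr : A →ₗ[k] k
  tr_homogeneous : ∀ p, p ≠ σ → ∀ a ∈ 𝒜 p, tr a = 0
  tr_symm : ∀ p q, ∀ a ∈ 𝒜 p, ∀ b ∈ 𝒜 q, tr (a * b) = sgn k (p * q) * tr (b * a)
  /-- the basis of `A` -/
  basis : Module.Basis ι k A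
  /-- the parities of the basis elements -/
  deg : ι → ZMod 2
  basis_mem : ∀ i, basis i ∈ 𝒜 (deg i)
  /-- the dual basis -/
  dual : Module.Basis ι k A
  tr_dual_mul : ∀ i j, tr (dual i * basis j) = if i = j then 1 else 0

variable {𝒜 : ZMod 2 → Submodule k A} [GradedAlgebra 𝒜] {ι : Type w} [Fintype ι] [DecidableEq ι]

/-- The element `b i ^∨` is homogeneous of parity `σ + |b i|`. -/
lemma SymmetricFrobenius.dual_mem (F : SymmetricFrobenius 𝒜 ι) (i : ι) :
    F.dual i ∈ 𝒜 (F.σ + F.deg i) := by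
  have nondeg : ∀ z : A, (∀ j, F.tr (z * F.basis j) = 0) → z = 0 := by
    intro z hz
    rw [← F.dual.sum_repr z]
    refine Finset.sum_eq_zero fun j _ => ?_
    have h := hz j
    rw [← F.dual.sum_repr z] at h
    simp only [Finset.sum_mul, smul_mul_assoc, map_sum, map_smul, F.tr_dual_mul] at h
    simp only [smul_eq_mul, mul_ite, mul_one, mul_zero, Finset.sum_ite_eq', Finset.mem_univ,
      if_true] at h
    rw [h, zero_smul]
  have vanish : ∀ q j, q + F.deg j ≠ F.σ →
      F.tr (GradedAlgebra.proj 𝒜 q (F.dual i) * F.basis j) = 0 := fun q j h =>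
    F.tr_homogeneous _ h _ (SetLike.mul_mem_graded
      (by rw [GradedAlgebra.proj_apply]; exact SetLike.coe_mem _) (F.basis_mem j))
  have hodd : GradedAlgebra.proj 𝒜 (F.σ + F.deg i + 1) (F.dual i) = 0 := by
    apply nondeg
    intro j
    by_cases hj : F.σ + F.deg i + 1 + F.deg j = F.σ
    · have hne : F.σ + F.deg i + F.deg j ≠ F.σ := by
        revert hj
        generalize F.σ = s, F.deg i = d, F.deg j = e
        revert s d e
        decide
      have hij : i ≠ j := by
        rintro rfl
        apply hne
        generalize F.σ = s, F.deg i = d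
        revert s d
        decide
      have key := F.tr_dual_mul i j
      rw [if_neg hij, ← sum_proj 𝒜 (F.dual i), Finset.sum_mul, map_sum,
        Finset.sum_eq_single (F.σ + F.deg i + 1)] at key
      · exact key
      · intro q _ hq
        apply vanish
        rw [show q = F.σ + F.deg i from ?_]
        · exact hne
        · revert hq
          generalize F.σ + F.deg i = s
          revert s q
          decide
      · simp
    · exact vanish _ _ hj
  have hsum := sum_proj 𝒜 (F.dual i)
  rw [Finset.sum_eq_single (F.σ + F.deg i)] at hsum
  · rw [← hsum, GradedAlgebra.proj_apply]
    exact SetLike.coe_mem _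
  · intro q _ hq
    rw [show q = F.σ + F.deg i + 1 from ?_]
    · exact hodd
    · revert hq
      generalize F.σ + F.deg i = s
      revert s q
      decide
  · simp

/-- The element `τ_i = 1 ⊗ ⋯ ⊗ 1 ⊗ τ ⊗ 1 ⊗ ⋯ ⊗ 1` of `A^{⊗n}`, with
`τ = ∑_b (-1)^{σ |b|} b ⊗ b^∨` in the factors `hi i` (left) and `lo i` (right). -/
def SymmetricFrobenius.tau (F : SymmetricFrobenius 𝒜 ι) {n : ℕ} (i : Fin (n - 1)) :
    SuperTensorPower 𝒜 n :=
  ∑ b : ι, sgn k (F.σ * F.deg b) • SuperTensorPower.tprod 𝒜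
    (fun j => if j = hi i then F.basis b else if j = lo i then F.dual b else 1)

end Frobenius

/-! ### Strict monoidal supercategories given by generators and relations

We construct the `k`-linear strict monoidal supercategory with one generating object, given
generating morphisms and given relations. Its objects are the tensor powers of the generating
object, that is, the natural numbers, with `m ⊗ n = m + n`. -/

section Supercategory

/-- Generating morphisms: each has a source, a target and a parity. -/
structure Signature where
  Gen : Type v
  src : Gen → ℕ
  tgt : Gen → ℕ
  par : Gen → ZMod 2

/-- Formal expressions for homogeneous morphisms `m → n` of parity `p`. -/
inductive Diagram (k : Type u) (S : Signature.{v}) : ℕ → ℕ → ZMod 2 → Type (max u v)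
  | gen (g : S.Gen) : Diagram k S (S.src g) (S.tgt g) (S.par g)
  | ident (n : ℕ) : Diagram k S n n 0
  /-- vertical composition `f ∘ g` -/
  | comp {l m n : ℕ} {p q : ZMod 2} (f : Diagram k S m n p) (g : Diagram k S l m q) :
      Diagram k S l n (p + q)
  /-- horizontal composition `f ⊗ g`, with `f` to the left of `g` -/
  | tens {m n m' n' : ℕ} {p q : ZMod 2} (f : Diagram k S m n p) (g : Diagram k S m' n' q) :
      Diagram k S (m + m') (n + n') (p + q)
  | zero (m n : ℕ) (p : ZMod 2) : Diagram k S m n p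
  | add {m n : ℕ} {p : ZMod 2} (f g : Diagram k S m n p) : Diagram k S m n p
  | smul {m n : ℕ} {p : ZMod 2} (c : k) (f : Diagram k S m n p) : Diagram k S m n p

namespace Diagram

variable {k : Type u} {S : Signature.{v}}

/-- Transport along equalities of source, target and parity. -/
def cast {m n m' n' : ℕ} {p p' : ZMod 2} (hm : m = m') (hn : n = n') (hp : p = p')
    (f : Diagram k S m n p) : Diagram k S m' n' p' := by
  subst hm hn hp; exact f

/-- The sum of a list of expressions. -/
def sum {m n : ℕ} {p : ZMod 2} (L : List (Diagram k S m n p)) : Diagram k S m n p :=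
  L.foldr add (zero m n p)

/-- The expression `1^{⊗l} ⊗ f ⊗ 1^{⊗r}`, as an endomorphism of `N = l + m + r`. -/
def whisker {m N : ℕ} {p : ZMod 2} (l r : ℕ) (h : l + m + r = N) (f : Diagram k S m m p) :
    Diagram k S N N p :=
  cast h h (by simp) (tens (tens (ident l) f) (ident r))

variable [CommRing k]

/-- A family of relations between parallel homogeneous morphisms. Both sides of a
relation `R f g` have equal parities; the two indices are kept apart because they may be
different expressions, such as `p + q` and `q + p`. -/
abbrev Relations (k : Type u) (S : Signature.{v}) :=
  ∀ ⦃m n : ℕ⦄ ⦃p q : ZMod 2⦄, Diagram k S m n p → Diagram k S m n q → Prop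

/-- The smallest congruence on formal expressions that contains the given relations `R` and the
axioms of a `k`-linear strict monoidal supercategory. Expressions over provably equal, but
different indices can be related, which makes the strict associativity and unit laws of the tensor
product meaningful. -/
inductive Rel (R : Relations k S) : ∀ {m n m' n' : ℕ} {p p' : ZMod 2},
    Diagram k S m n p → Diagram k S m' n' p' → Prop
  /- the given relations -/
  | of {m n : ℕ} {p q : ZMod 2} (f : Diagram k S m n p) (g : Diagram k S m n q) (h : p = q) :
      R f g → Rel R f g
  /- equivalence relation -/
  | refl {m n p} (f : Diagram k S m n p) : Rel R f f
  | symm {m n m' n' p p'} {f : Diagram k S m n p} {g : Diagram k S m' n' p'} :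
      Rel R f g → Rel R g f
  | trans {m n m' n' m'' n'' p p' p''} {f : Diagram k S m n p} {g : Diagram k S m' n' p'}
      {h : Diagram k S m'' n'' p''} : Rel R f g → Rel R g h → Rel R f h
  /- compatibility with the operations -/
  | comp_congr {l m n l' m' n' p q p' q'} {f : Diagram k S m n p} {g : Diagram k S l m q}
      {f' : Diagram k S m' n' p'} {g' : Diagram k S l' m' q'} :
      Rel R f f' → Rel R g g' → Rel R (comp f g) (comp f' g')
  | tens_congr {a b c d a' b' c' d' p q p' q'} {f : Diagram k S a b p} {g : Diagram k S c d q}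
      {f' : Diagram k S a' b' p'} {g' : Diagram k S c' d' q'} :
      Rel R f f' → Rel R g g' → Rel R (tens f g) (tens f' g')
  | add_congr {m n m' n' p p'} {f g : Diagram k S m n p} {f' g' : Diagram k S m' n' p'} :
      Rel R f f' → Rel R g g' → Rel R (add f g) (add f' g')
  | smul_congr {m n m' n' p p'} (c : k) {f : Diagram k S m n p} {f' : Diagram k S m' n' p'} :
      Rel R f f' → Rel R (smul c f) (smul c f')
  /- morphisms `m → n` of parity `p` form a `k`-module -/
  | add_assoc {m n p} (f g h : Diagram k S m n p) :
      Rel R (add (add f g) h) (add f (add g h))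
  | add_comm {m n p} (f g : Diagram k S m n p) : Rel R (add f g) (add g f)
  | zero_add {m n p} (f : Diagram k S m n p) : Rel R (add (zero m n p) f) f
  | smul_add {m n p} (c : k) (f g : Diagram k S m n p) :
      Rel R (smul c (add f g)) (add (smul c f) (smul c g))
  | add_smul {m n p} (c d : k) (f : Diagram k S m n p) :
      Rel R (smul (c + d) f) (add (smul c f) (smul d f))
  | mul_smul {m n p} (c d : k) (f : Diagram k S m n p) :
      Rel R (smul (c * d) f) (smul c (smul d f))
  | one_smul {m n p} (f : Diagram k S m n p) : Rel R (smul 1 f) f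
  | zero_smul {m n p} (f : Diagram k S m n p) : Rel R (smul 0 f) (zero m n p)
  /- composition and tensor product are bilinear -/
  | add_comp {l m n p q} (f f' : Diagram k S m n p) (g : Diagram k S l m q) :
      Rel R (comp (add f f') g) (add (comp f g) (comp f' g))
  | comp_add {l m n p q} (f : Diagram k S m n p) (g g' : Diagram k S l m q) :
      Rel R (comp f (add g g')) (add (comp f g) (comp f g'))
  | smul_comp {l m n p q} (c : k) (f : Diagram k S m n p) (g : Diagram k S l m q) :
      Rel R (comp (smul c f) g) (smul c (comp f g))
  | comp_smul {l m n p q} (c : k) (f : Diagram k S m n p) (g : Diagram k S l m q) :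
      Rel R (comp f (smul c g)) (smul c (comp f g))
  | add_tens {m n m' n' p q} (f f' : Diagram k S m n p) (g : Diagram k S m' n' q) :
      Rel R (tens (add f f') g) (add (tens f g) (tens f' g))
  | tens_add {m n m' n' p q} (f : Diagram k S m n p) (g g' : Diagram k S m' n' q) :
      Rel R (tens f (add g g')) (add (tens f g) (tens f g'))
  | smul_tens {m n m' n' p q} (c : k) (f : Diagram k S m n p) (g : Diagram k S m' n' q) :
      Rel R (tens (smul c f) g) (smul c (tens f g))
  | tens_smul {m n m' n' p q} (c : k) (f : Diagram k S m n p) (g : Diagram k S m' n' q) :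
      Rel R (tens f (smul c g)) (smul c (tens f g))
  /- category -/
  | id_comp {m n p} (f : Diagram k S m n p) : Rel R (comp (ident n) f) f
  | comp_id {m n p} (f : Diagram k S m n p) : Rel R (comp f (ident m)) f
  | comp_assoc {a b c d p q r} (f : Diagram k S c d p) (g : Diagram k S b c q)
      (h : Diagram k S a b r) : Rel R (comp (comp f g) h) (comp f (comp g h))
  /- strict monoidal structure -/
  | tens_id (m n : ℕ) : Rel R (tens (ident m) (ident n)) (ident (m + n))
  | id_tens {m n p} (f : Diagram k S m n p) : Rel R (tens (ident 0) f) f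
  | tens_id_zero {m n p} (f : Diagram k S m n p) : Rel R (tens f (ident 0)) f
  | tens_assoc {a b c d a' b' p q r} (f : Diagram k S a b p) (g : Diagram k S c d q)
      (h : Diagram k S a' b' r) : Rel R (tens (tens f g) h) (tens f (tens g h))
  /- super interchange law -/
  | interchange {a b c a' b' c' p q p' q'} (f' : Diagram k S b c p') (g : Diagram k S b' c' q)
      (f : Diagram k S a b p) (g' : Diagram k S a' b' q') :
      Rel R (comp (tens f' g) (tens f g'))
        (smul (sgn k (p * q)) (tens (comp f' f) (comp g g')))

lemma Rel.cast_left (R : Relations k S) {m n m' n' : ℕ} {p p' : ZMod 2} (hm : m = m')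
    (hn : n = n') (hp : p = p') (f : Diagram k S m n p) : Rel R (cast hm hn hp f) f := by
  subst hm hn hp; exact Rel.refl f

/-- Formal expressions of a fixed type up to the relation `Rel R`. -/
def homSetoid (R : Relations k S) (m n : ℕ) (p : ZMod 2) : Setoid (Diagram k S m n p) where
  r f g := Rel R f g
  iseqv := ⟨Rel.refl, Rel.symm, Rel.trans⟩

/-- The morphisms `m → n` of parity `p` in the strict monoidal supercategory with generators `S` and
relations `R`. The whole morphism superspace is `⨁ p, Hom R m n p`. -/
def Hom (R : Relations k S) (m n : ℕ) (p : ZMod 2) : Type (max u v) :=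
  Quotient (homSetoid R m n p)

/-- The morphism represented by a formal expression. -/
def toHom (R : Relations k S) {m n : ℕ} {p : ZMod 2} (f : Diagram k S m n p) : Hom R m n p :=
  Quotient.mk (homSetoid R m n p) f

variable (R : Relations k S)

lemma toHom_eq {m n : ℕ} {p : ZMod 2} {f g : Diagram k S m n p} (h : Rel R f g) :
    toHom R f = toHom R g := Quotient.sound (s := homSetoid R m n p) h

lemma toHom_sigma_eq {n : ℕ} {p q : ZMod 2} {f : Diagram k S n n p} {g : Diagram k S n n q}
    (hpq : p = q) (h : Rel R f g) :
    (⟨p, toHom R f⟩ : GradedMonoid (Hom R n n)) = ⟨q, toHom R g⟩ := by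
  subst hpq; rw [toHom_eq R h]

lemma toHom_surjective {m n : ℕ} {p : ZMod 2} (f : Hom R m n p) :
    ∃ f' : Diagram k S m n p, f = toHom R f' := by
  induction f using Quotient.inductionOn with
  | h f => exact ⟨f, rfl⟩

instance (m n : ℕ) (p : ZMod 2) : Zero (Hom R m n p) := ⟨toHom R (zero m n p)⟩

instance (m n : ℕ) (p : ZMod 2) : Add (Hom R m n p) :=
  ⟨Quotient.map₂ add fun _ _ h _ _ h' => Rel.add_congr h h'⟩

instance (m n : ℕ) (p : ZMod 2) : SMul k (Hom R m n p) :=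
  ⟨fun c => Quotient.map (smul c) fun _ _ h => Rel.smul_congr c h⟩

/-- Composition of homogeneous morphisms. -/
def Hom.comp {l m n : ℕ} {p q : ZMod 2} : Hom R m n p → Hom R l m q → Hom R l n (p + q) :=
  Quotient.map₂ Diagram.comp fun _ _ h _ _ h' => Rel.comp_congr h h'

lemma toHom_add {m n : ℕ} {p : ZMod 2} (f g : Diagram k S m n p) :
    toHom R f + toHom R g = toHom R (add f g) := rfl

lemma toHom_smul {m n : ℕ} {p : ZMod 2} (c : k) (f : Diagram k S m n p) :
    c • toHom R f = toHom R (smul c f) := rfl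

lemma toHom_zero (m n : ℕ) (p : ZMod 2) : (0 : Hom R m n p) = toHom R (zero m n p) := rfl

lemma toHom_comp {l m n : ℕ} {p q : ZMod 2} (f : Diagram k S m n p) (g : Diagram k S l m q) :
    Hom.comp R (toHom R f) (toHom R g) = toHom R (Diagram.comp f g) := rfl

instance (m n : ℕ) (p : ZMod 2) : AddCommMonoid (Hom R m n p) where
  add_assoc f g h := by
    obtain ⟨f, rfl⟩ := toHom_surjective R f
    obtain ⟨g, rfl⟩ := toHom_surjective R g
    obtain ⟨h, rfl⟩ := toHom_surjective R h
    exact toHom_eq R (Rel.add_assoc f g h)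
  add_comm f g := by
    obtain ⟨f, rfl⟩ := toHom_surjective R f
    obtain ⟨g, rfl⟩ := toHom_surjective R g
    exact toHom_eq R (Rel.add_comm f g)
  zero_add f := by
    obtain ⟨f, rfl⟩ := toHom_surjective R f
    exact toHom_eq R (Rel.zero_add f)
  add_zero f := by
    obtain ⟨f, rfl⟩ := toHom_surjective R f
    exact toHom_eq R ((Rel.add_comm _ _).trans (Rel.zero_add f))
  nsmul := nsmulRec

instance (m n : ℕ) (p : ZMod 2) : Module k (Hom R m n p) where
  one_smul f := by
    obtain ⟨f, rfl⟩ := toHom_surjective R f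
    exact toHom_eq R (Rel.one_smul f)
  mul_smul c d f := by
    obtain ⟨f, rfl⟩ := toHom_surjective R f
    exact toHom_eq R (Rel.mul_smul c d f)
  smul_add c f g := by
    obtain ⟨f, rfl⟩ := toHom_surjective R f
    obtain ⟨g, rfl⟩ := toHom_surjective R g
    exact toHom_eq R (Rel.smul_add c f g)
  add_smul c d f := by
    obtain ⟨f, rfl⟩ := toHom_surjective R f
    exact toHom_eq R (Rel.add_smul c d f)
  zero_smul f := by
    obtain ⟨f, rfl⟩ := toHom_surjective R f
    exact toHom_eq R (Rel.zero_smul f)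
  smul_zero c := by
    rw [toHom_zero]
    refine toHom_eq R ((Rel.smul_congr c (Rel.zero_smul (zero m n p)).symm).trans ?_)
    refine (Rel.mul_smul c 0 _).symm.trans ?_
    rw [mul_zero]
    exact Rel.zero_smul _

instance (m n : ℕ) (p : ZMod 2) : AddCommGroup (Hom R m n p) :=
  Module.addCommMonoidToAddCommGroup k

instance (n : ℕ) : GradedMonoid.GOne (Hom R n n) where
  one := toHom R (ident n)

/-- Endomorphisms of the object `n`, multiplied by composition. -/
instance (n : ℕ) : GradedMonoid.GMul (Hom R n n) where
  mul f g := Hom.comp R f g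

instance (n : ℕ) : DirectSum.GSemiring (Hom R n n) where
  mul_zero {p q} f := by
    obtain ⟨f, rfl⟩ := toHom_surjective R f
    refine toHom_eq R ?_
    exact (Rel.comp_congr (Rel.refl f) (Rel.zero_smul (zero n n q)).symm).trans
      ((Rel.comp_smul _ _ _).trans (Rel.zero_smul _))
  zero_mul {p q} f := by
    obtain ⟨f, rfl⟩ := toHom_surjective R f
    refine toHom_eq R ?_
    exact (Rel.comp_congr (Rel.zero_smul (zero n n p)).symm (Rel.refl f)).trans
      ((Rel.smul_comp _ _ _).trans (Rel.zero_smul _))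
  mul_add f g h := by
    obtain ⟨f, rfl⟩ := toHom_surjective R f
    obtain ⟨g, rfl⟩ := toHom_surjective R g
    obtain ⟨h, rfl⟩ := toHom_surjective R h
    exact toHom_eq R (Rel.comp_add f g h)
  add_mul f g h := by
    obtain ⟨f, rfl⟩ := toHom_surjective R f
    obtain ⟨g, rfl⟩ := toHom_surjective R g
    obtain ⟨h, rfl⟩ := toHom_surjective R h
    exact toHom_eq R (Rel.add_comp f g h)
  one_mul := by
    rintro ⟨p, f⟩
    obtain ⟨f, rfl⟩ := toHom_surjective R f
    exact toHom_sigma_eq R (_root_.zero_add p) (Rel.id_comp f)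
  mul_one := by
    rintro ⟨p, f⟩
    obtain ⟨f, rfl⟩ := toHom_surjective R f
    exact toHom_sigma_eq R (_root_.add_zero p) (Rel.comp_id f)
  mul_assoc := by
    rintro ⟨p, f⟩ ⟨q, g⟩ ⟨r, h⟩
    obtain ⟨f, rfl⟩ := toHom_surjective R f
    obtain ⟨g, rfl⟩ := toHom_surjective R g
    obtain ⟨h, rfl⟩ := toHom_surjective R h
    exact toHom_sigma_eq R (_root_.add_assoc p q r) (Rel.comp_assoc f g h)
  natCast c := c • toHom R (ident n)
  natCast_zero := _root_.zero_smul _ _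
  natCast_succ c := by rw [_root_.add_smul, _root_.one_smul]; rfl

instance (n : ℕ) : DirectSum.GRing (Hom R n n) where
  intCast c := c • toHom R (ident n)
  intCast_ofNat c := natCast_zsmul _ c
  intCast_negSucc_ofNat c := negSucc_zsmul _ c

instance (n : ℕ) : DirectSum.GAlgebra k (Hom R n n) where
  toFun :=
    { toFun := fun c => c • toHom R (ident n)
      map_zero' := _root_.zero_smul _ _
      map_add' := fun c d => _root_.add_smul c d _ }
  map_one := _root_.one_smul _ _
  map_mul c d := by
    refine toHom_sigma_eq R (_root_.add_zero 0).symm ?_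
    refine Rel.trans ?_ (Rel.smul_comp _ _ _).symm
    exact (Rel.mul_smul _ _ _).trans (Rel.smul_congr _ (Rel.id_comp _).symm)
  commutes c := by
    rintro ⟨p, f⟩
    obtain ⟨f, rfl⟩ := toHom_surjective R f
    refine toHom_sigma_eq R (_root_.add_comm 0 p) ?_
    refine (Rel.smul_comp _ _ _).trans (Rel.trans ?_ (Rel.comp_smul _ _ _).symm)
    exact Rel.smul_congr _ ((Rel.id_comp _).trans (Rel.comp_id _).symm)
  smul_def c := by
    rintro ⟨p, f⟩
    obtain ⟨f, rfl⟩ := toHom_surjective R f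
    refine toHom_sigma_eq R (_root_.zero_add p).symm ?_
    exact Rel.trans (Rel.smul_congr _ (Rel.id_comp _).symm) (Rel.smul_comp _ _ _).symm

/-- The endomorphism algebra of the object `n`, that is, of the `n`-th tensor power of the
generating object. -/
abbrev EndAlg (n : ℕ) : Type (max u v) := ⨁ p, Hom R n n p

/-- The part of parity `p` of the endomorphism superalgebra. -/
def EndAlg.parity (n : ℕ) (p : ZMod 2) : Submodule k (EndAlg R n) :=
  LinearMap.range (DirectSum.lof k (ZMod 2) (Hom R n n) p)

/-- The parts of parity `0` and `1` make the endomorphism algebra a superalgebra. -/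
instance (n : ℕ) : GradedAlgebra (EndAlg.parity R n) where
  one_mem := ⟨toHom R (ident n), rfl⟩
  mul_mem := by
    rintro p q _ _ ⟨f, rfl⟩ ⟨g, rfl⟩
    exact ⟨Hom.comp R f g, (DirectSum.of_mul_of f g).symm⟩
  decompose' := DirectSum.toAddMonoid fun p =>
    (DirectSum.of (fun p => EndAlg.parity R n p) p).comp
      (LinearMap.rangeRestrict (DirectSum.lof k (ZMod 2) (Hom R n n) p)).toAddMonoidHom
  left_inv x := by
    induction x using DirectSum.induction_on with
    | zero => simp
    | of p f =>
      rw [DirectSum.toAddMonoid_of]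
      exact DirectSum.coeAddMonoidHom_of (EndAlg.parity R n) p _
    | add x y hx hy => rw [map_add, map_add, hx, hy]
  right_inv x := by
    induction x using DirectSum.induction_on with
    | zero => simp
    | of p f =>
      obtain ⟨_, f, rfl⟩ := f
      simp [DirectSum.lof_eq_of]
      rfl
    | add x y hx hy => rw [map_add, map_add, hx, hy]

/-- The element of the endomorphism superalgebra represented by a formal expression. -/
def toEnd {n : ℕ} {p : ZMod 2} (f : Diagram k S n n p) : EndAlg R n :=
  DirectSum.of (Hom R n n) p (toHom R f)

end Diagram

end Supercategory

/-! ### The Frobenius nilHecke category and algebra -/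

section NilHecke

variable {k : Type u} [CommRing k] {A : Type v} [Ring A] [Algebra k A]
variable {𝒜 : ZMod 2 → Submodule k A} [GradedAlgebra 𝒜] {ι : Type w} [Fintype ι] [DecidableEq ι]

/-- The generating morphisms: crossing, dot, and tokens. The tokens are labeled by the homogeneous
elements of `A`. -/
inductive NHGen (𝒜 : ZMod 2 → Submodule k A) : Type v
  | cross
  | dot
  | token (p : ZMod 2) (a : 𝒜 p)

/-- The crossing is an even endomorphism of the object `2`, the dot is an endomorphism of the
object `1` of parity `σ`, and a token is an endomorphism of the object `1` of the parity of its
label. -/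
def NHSig (F : SymmetricFrobenius 𝒜 ι) : Signature.{v} where
  Gen := NHGen 𝒜
  src | .cross => 2 | .dot => 1 | .token _ _ => 1
  tgt | .cross => 2 | .dot => 1 | .token _ _ => 1
  par | .cross => 0 | .dot => F.σ | .token p _ => p

open Diagram

/-- The crossing. -/
def cross (F : SymmetricFrobenius 𝒜 ι) : Diagram k (NHSig F) 2 2 0 :=
  gen (S := NHSig F) (NHGen.cross (𝒜 := 𝒜))

/-- The crossing with a further strand to its right. -/
def crossLeft (F : SymmetricFrobenius 𝒜 ι) : Diagram k (NHSig F) 3 3 0 :=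
  cast rfl rfl (by simp) (tens (cross F) (ident 1))

/-- The crossing with a further strand to its left. -/
def crossRight (F : SymmetricFrobenius 𝒜 ι) : Diagram k (NHSig F) 3 3 0 :=
  cast rfl rfl (by simp) (tens (ident 1) (cross F))

/-- The dot. -/
def dot (F : SymmetricFrobenius 𝒜 ι) : Diagram k (NHSig F) 1 1 F.σ :=
  gen (S := NHSig F) (NHGen.dot (𝒜 := 𝒜))

/-- The token labeled by `a`. -/
def token (F : SymmetricFrobenius 𝒜 ι) {p : ZMod 2} (a : 𝒜 p) : Diagram k (NHSig F) 1 1 p :=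
  gen (S := NHSig F) (NHGen.token p a)

/-- The teleporter `∑_b (-1)^{σ |b|} b ⊗ b^∨`. -/
def teleporter (F : SymmetricFrobenius 𝒜 ι) : Diagram k (NHSig F) 2 2 F.σ :=
  Diagram.sum (Finset.univ.toList.map fun b : ι =>
    smul (sgn k (F.σ * F.deg b))
      (cast rfl rfl
        (show F.deg b + (F.σ + F.deg b) = F.σ by
          generalize F.σ = s, F.deg b = d
          revert s d
          decide)
        (tens (token F ⟨F.basis b, F.basis_mem b⟩) (token F ⟨F.dual b, F.dual_mem b⟩))))

/-- The defining relations of the Frobenius nilHecke category. -/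
inductive NHRel (F : SymmetricFrobenius 𝒜 ι) : ∀ ⦃m n : ℕ⦄ ⦃p q : ZMod 2⦄,
    Diagram k (NHSig F) m n p → Diagram k (NHSig F) m n q → Prop
  /- the tokens define a homomorphism of superalgebras -/
  | token_one : NHRel F (token F (p := 0) ⟨1, SetLike.GradedOne.one_mem⟩) (ident 1)
  | token_linear {p : ZMod 2} (c d : k) (a b : 𝒜 p) :
      NHRel F (token F (c • a + d • b)) (add (smul c (token F a)) (smul d (token F b)))
  | token_mul {p q : ZMod 2} (a : 𝒜 p) (b : 𝒜 q) :
      NHRel F (comp (token F a) (token F b))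
        (token F (p := p + q) ⟨a * b, SetLike.GradedMul.mul_mem a.2 b.2⟩)
  /- the nilCoxeter relations -/
  | cross_cross : NHRel F (comp (cross F) (cross F)) (zero 2 2 0)
  | braid :
      NHRel F
        (comp (crossLeft F) (comp (crossRight F) (crossLeft F)))
        (comp (crossRight F) (comp (crossLeft F) (crossRight F)))
  /- tokens slide through crossings -/
  | cross_token_left {p : ZMod 2} (a : 𝒜 p) :
      NHRel F (comp (cross F) (tens (token F a) (ident 1))) (comp (tens (ident 1) (token F a)) (cross F))
  | cross_token_right {p : ZMod 2} (a : 𝒜 p) :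
      NHRel F (comp (cross F) (tens (ident 1) (token F a))) (comp (tens (token F a) (ident 1)) (cross F))
  /- dots slide through crossings up to teleporters -/
  | cross_dot_left :
      NHRel F (comp (cross F) (tens (dot F) (ident 1)))
        (add (cast rfl rfl (show 0 + F.σ + 0 = F.σ by simp)
          (comp (tens (ident 1) (dot F)) (cross F))) (teleporter F))
  | dot_cross_left :
      NHRel F (comp (tens (dot F) (ident 1)) (cross F))
        (add (cast rfl rfl (show 0 + (0 + F.σ) = F.σ by simp)
          (comp (cross F) (tens (ident 1) (dot F)))) (smul (sgn k F.σ) (teleporter F)))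
  /- dots and tokens supercommute -/
  | token_dot {p : ZMod 2} (a : 𝒜 p) :
      NHRel F (comp (token F a) (dot F)) (smul (sgn k (F.σ * p)) (comp (dot F) (token F a)))

/-- The Frobenius nilHecke algebra: the endomorphism superalgebra of the `n`-th tensor power of the
generating object of the Frobenius nilHecke category. -/
abbrev NilHeckeAlg (F : SymmetricFrobenius 𝒜 ι) (n : ℕ) : Type (max u v) :=
  EndAlg (NHRel F) n

/-- The crossing of the strands `lo i` and `hi i`; strands are numbered from right to left. -/
def NilHeckeAlg.crossing (F : SymmetricFrobenius 𝒜 ι) {n : ℕ} (i : Fin (n - 1)) :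
    NilHeckeAlg F n :=
  toEnd (NHRel F) (whisker (n - 2 - i) i (by omega) (cross F))

/-- The dot on the strand `j`. -/
def NilHeckeAlg.dotOn (F : SymmetricFrobenius 𝒜 ι) {n : ℕ} (j : Fin n) : NilHeckeAlg F n :=
  toEnd (NHRel F) (whisker (n - 1 - j) j (by omega) (dot F))

/-- The token labeled `a` on the strand `j`. -/
def NilHeckeAlg.tokenOn (F : SymmetricFrobenius 𝒜 ι) {n : ℕ} (j : Fin n) {p : ZMod 2} (a : 𝒜 p) :
    NilHeckeAlg F n :=
  toEnd (NHRel F) (whisker (n - 1 - j) j (by omega) (token F a))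

/-! ### The presented superalgebra -/

/-- The generators `u_i`, `1 ≤ i ≤ n - 1`, and `x_j`, `1 ≤ j ≤ n` (here numbered from zero). -/
inductive NHVar (n : ℕ) : Type v
  | u (i : Fin (n - 1))
  | x (j : Fin n)

/-- The two factors of the free product: `A^{⊗n}` and the free associative algebra on the `u_i`
and `x_j`. -/
def NHFactor (𝒜 : ZMod 2 → Submodule k A) (n : ℕ) : Bool → Type (max u v)
  | true => SuperTensorPower 𝒜 n
  | false => FreeAlgebra k (NHVar.{v} n)

instance (n : ℕ) : ∀ b, Ring (NHFactor 𝒜 n b)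
  | true => inferInstanceAs (Ring (SuperTensorPower 𝒜 n))
  | false => inferInstanceAs (Ring (FreeAlgebra k (NHVar.{v} n)))

instance (n : ℕ) : ∀ b, Algebra k (NHFactor 𝒜 n b)
  | true => inferInstanceAs (Algebra k (SuperTensorPower 𝒜 n))
  | false => inferInstanceAs (Algebra k (FreeAlgebra k (NHVar.{v} n)))

/-- The free product of `A^{⊗n}` and the free associative algebra on the `u_i` and `x_j`. -/
abbrev NHFree (𝒜 : ZMod 2 → Submodule k A) [GradedAlgebra 𝒜] (n : ℕ) : Type _ :=
  LinearAlgebra.FreeProduct k (NHFactor 𝒜 n)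

/-- The image of an element of `A^{⊗n}` in the free product. -/
def NHFree.tens (n : ℕ) (a : SuperTensorPower 𝒜 n) : NHFree 𝒜 n :=
  LinearAlgebra.FreeProduct.ι k (NHFactor 𝒜 n) true a

/-- The generators `u_i` in the free product. -/
def NHFree.u (𝒜 : ZMod 2 → Submodule k A) [GradedAlgebra 𝒜] {n : ℕ} (i : Fin (n - 1)) :
    NHFree 𝒜 n :=
  LinearAlgebra.FreeProduct.ι k (NHFactor 𝒜 n) false (FreeAlgebra.ι k (NHVar.u.{v} i))

/-- The generators `x_j` in the free product. -/
def NHFree.x (𝒜 : ZMod 2 → Submodule k A) [GradedAlgebra 𝒜] {n : ℕ} (j : Fin n) : NHFree 𝒜 n :=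
  LinearAlgebra.FreeProduct.ι k (NHFactor 𝒜 n) false (FreeAlgebra.ι k (NHVar.x.{v} j))

open NHFree in
/-- The relations of the presentation. -/
inductive PresRel (F : SymmetricFrobenius 𝒜 ι) (n : ℕ) : NHFree 𝒜 n → NHFree 𝒜 n → Prop
  | u_sq (i) : PresRel F n (u 𝒜 i * u 𝒜 i) 0
  | u_comm (i j : Fin (n - 1)) : (i : ℕ) + 1 < j ∨ (j : ℕ) + 1 < i →
      PresRel F n (u 𝒜 i * u 𝒜 j) (u 𝒜 j * u 𝒜 i)
  | u_braid (i j : Fin (n - 1)) : (j : ℕ) = i + 1 →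
      PresRel F n (u 𝒜 i * u 𝒜 j * u 𝒜 i) (u 𝒜 j * u 𝒜 i * u 𝒜 j)
  | u_tens (i) (a : SuperTensorPower 𝒜 n) :
      PresRel F n (u 𝒜 i * tens n a) (tens n (superSwap 𝒜 i a) * u 𝒜 i)
  | x_comm (i j : Fin n) : i ≠ j →
      PresRel F n (x 𝒜 i * x 𝒜 j) (sgn k F.σ • (x 𝒜 j * x 𝒜 i))
  | tens_x (p : ZMod 2) (a : SuperTensorPower 𝒜 n) (j : Fin n) :
      a ∈ SuperTensorPower.parity 𝒜 n p →
      PresRel F n (tens n a * x 𝒜 j) (sgn k (F.σ * p) • (x 𝒜 j * tens n a))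
  | x_u_comm (i : Fin (n - 1)) (j : Fin n) : j ≠ lo i → j ≠ hi i →
      PresRel F n (x 𝒜 j * u 𝒜 i) (u 𝒜 i * x 𝒜 j)
  | u_x (i) :
      PresRel F n (u 𝒜 i * x 𝒜 (hi i)) (x 𝒜 (lo i) * u 𝒜 i + tens n (F.tau i))
  | x_u (i) :
      PresRel F n (x 𝒜 (hi i) * u 𝒜 i) (u 𝒜 i * x 𝒜 (lo i) + sgn k F.σ • tens n (F.tau i))

/-- The algebra with the given presentation. -/
abbrev PresAlg (F : SymmetricFrobenius 𝒜 ι) (n : ℕ) : Type _ := RingQuot (PresRel F n)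

namespace PresAlg

/-- The image of an element of `A^{⊗n}`. -/
def tens (F : SymmetricFrobenius 𝒜 ι) {n : ℕ} (a : SuperTensorPower 𝒜 n) : PresAlg F n :=
  RingQuot.mkAlgHom k (PresRel F n) (NHFree.tens n a)

/-- The generator `u_i`. -/
def u (F : SymmetricFrobenius 𝒜 ι) {n : ℕ} (i : Fin (n - 1)) : PresAlg F n :=
  RingQuot.mkAlgHom k (PresRel F n) (NHFree.u 𝒜 i)

/-- The generator `x_j`. -/
def x (F : SymmetricFrobenius 𝒜 ι) {n : ℕ} (j : Fin n) : PresAlg F n :=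
  RingQuot.mkAlgHom k (PresRel F n) (NHFree.x 𝒜 j)

/-- Products of homogeneous generators, with their parity: the elements of `A^{⊗n}` have the parity
that they have there, the `u_i` are even and the `x_j` have parity `σ`. -/
inductive IsWord (F : SymmetricFrobenius 𝒜 ι) (n : ℕ) : ZMod 2 → PresAlg F n → Prop
  | one : IsWord F n 0 1
  | tens_mul {p q : ZMod 2} (a : SuperTensorPower 𝒜 n) (y : PresAlg F n) :
      a ∈ SuperTensorPower.parity 𝒜 n p → IsWord F n q y → IsWord F n (p + q) (tens F a * y)
  | u_mul {q : ZMod 2} (i : Fin (n - 1)) (y : PresAlg F n) :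
      IsWord F n q y → IsWord F n q (u F i * y)
  | x_mul {q : ZMod 2} (j : Fin n) (y : PresAlg F n) :
      IsWord F n q y → IsWord F n (F.σ + q) (x F j * y)

/-- The part of parity `p` of the presented superalgebra. -/
def parity (F : SymmetricFrobenius 𝒜 ι) (n : ℕ) (p : ZMod 2) : Submodule k (PresAlg F n) :=
  Submodule.span k {y | IsWord F n p y}

end PresAlg

/-- The element `1 ⊗ ⋯ ⊗ a ⊗ ⋯ ⊗ 1` of `A^{⊗n}`, with `a` in the factor `j`. -/
def SuperTensorPower.single (𝒜 : ZMod 2 → Submodule k A) {n : ℕ} (j : Fin n) (a : A) :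
    SuperTensorPower 𝒜 n :=
  SuperTensorPower.tprod 𝒜 (fun i => if i = j then a else 1)

end NilHecke

end FrobeniusNilHecke

end

open FrobeniusNilHecke

/-! The proof only compares two presentations; no basis theorem enters. Homomorphisms are built in
both directions and shown to be mutually inverse.

From the presented algebra to the category (`NilHeckeAlg.ofPres`): generators go to crossings, dots
and tokens on the appropriate strands. The relations between generators on disjoint strands are not
among the defining relations of the category; they are consequences of the super interchange law
(`superCommute_whiskerEnd`). The remaining ones are the defining relations with identity strands
added on both sides. The factor `A^{⊗n}` is handled by its universal property
(`SuperTensorPower.lift`): it is generated by its `n` copies of `A`, which supercommute with each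
other.

From the category to the presented algebra (`NilHeckeAlg.toPres`): a formal expression is evaluated
recursively, with the position `r` of its rightmost strand as a parameter. Composition and tensor
product both become multiplication, and in a tensor product the left factor is evaluated further to
the left by the number of strands of the right factor (`PresAlg.eval`). Almost every axiom of a
monoidal supercategory then becomes a ring axiom. The exception is the interchange law, which says
that values on disjoint strands supercommute (`PresAlg.superCommute_eval`); this reduces to the far
commutation relations of the presentation. Since every generating morphism has as many outputs as
inputs, expressions with different source and target evaluate to zero, so changes of the strand
count in the middle of an expression do no harm.

One composite is the identity because it fixes the generators. For the other, structural induction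
on expressions shows that evaluating an expression and mapping the value back gives the expression
with identity strands added on both sides (`NilHeckeAlg.ofPres_eval`); with no added strands this is
the original morphism. Both maps respect parity, whence the statement on parities. -/

namespace FrobeniusNilHecke

universe u v w

/-! ### Products in decreasing order of the index, and the signs from reordering them. -/

section OrderedProducts

/-- The product `c (n - 1) * ⋯ * c 1 * c 0`. -/
def revProd {E : Type*} [Monoid E] (c : ℕ → E) : ℕ → E
  | 0 => 1
  | n + 1 => c n * revProd c n

lemma revProd_congr {E : Type*} [Monoid E] {c d : ℕ → E} (n : ℕ) (h : ∀ i < n, c i = d i) :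
    revProd c n = revProd d n := by
  induction n with
  | zero => rfl
  | succ n ih => rw [revProd, revProd, h n (by omega), ih fun i hi => h i (by omega)]

lemma map_revProd {E E' M : Type*} [Monoid E] [Monoid E'] [FunLike M E E'] [MonoidHomClass M E E']
    (f : M) (c : ℕ → E) (n : ℕ) : f (revProd c n) = revProd (fun i => f (c i)) n := by
  induction n with
  | zero => exact map_one f
  | succ n ih => rw [revProd, revProd, map_mul, ih]

lemma revProd_eq_prod_ofFn {E : Type*} [Monoid E] (c : ℕ → E) (n : ℕ) :
    revProd c n = (List.ofFn fun i : Fin n => c (n - (i + 1))).prod := by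
  induction n with
  | zero => simp [revProd]
  | succ n ih =>
    rw [revProd, ih, List.ofFn_succ, List.prod_cons]
    simp

lemma revProd_eq_single {E : Type*} [Monoid E] (c : ℕ → E) (j n : ℕ) (hj : j < n)
    (h : ∀ i < n, i ≠ j → c i = 1) : revProd c n = c j := by
  have below : ∀ m ≤ j, revProd c m = 1 := by
    intro m hm
    induction m with
    | zero => rfl
    | succ m ih => rw [revProd, ih (by omega), h m (by omega) (by omega), one_mul]
  induction n with
  | zero => omega
  | succ n ih =>
    rcases Nat.lt_or_ge j n with hn | hn
    · rw [revProd, h n (by omega) (by omega), one_mul, ih hn fun i hi => h i (by omega)]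
    · obtain rfl : n = j := by omega
      rw [revProd, below n le_rfl, mul_one]

variable {k : Type u} [CommRing k] {E : Type*} [Ring E] [Algebra k E]

lemma sgn_mul_self (p : ZMod 2) : sgn k p * sgn k p = 1 := by
  rcases zmod2_cases p with rfl | rfl <;> simp [sgn_zero, sgn_one]

lemma sgn_sq_arg (p : ZMod 2) : sgn k (p * p) = sgn k p := by
  rcases zmod2_cases p with rfl | rfl <;> simp

lemma revProd_mul_comm (p q : ℕ → ZMod 2) (c d : ℕ → E) (n m : ℕ)
    (h : ∀ i < n, c i * d m = sgn k (p i * q m) • (d m * c i)) :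
    revProd c n * d m = sgn k (∑ i ∈ Finset.range n, p i * q m) • (d m * revProd c n) := by
  induction n with
  | zero => simp [revProd, sgn_zero]
  | succ n ih =>
    rw [revProd, mul_assoc, ih fun i hi => h i (by omega), mul_smul_comm, ← mul_assoc,
      h n (by omega), Finset.sum_range_succ, sgn_add, smul_mul_assoc, smul_smul, mul_assoc]

/-- To stand next to `c j`, the factor `d j` must pass exactly the `c i` with `i < j`. The
accumulated sign is therefore the Koszul sign of `A^{⊗n}`. -/
lemma revProd_mul_revProd (p q : ℕ → ZMod 2) (c d : ℕ → E) (n : ℕ)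
    (h : ∀ i j, i < j → j < n → c i * d j = sgn k (p i * q j) • (d j * c i)) :
    revProd c n * revProd d n =
      sgn k (∑ j ∈ Finset.range n, ∑ i ∈ Finset.range j, p i * q j) •
        revProd (fun i => c i * d i) n := by
  induction n with
  | zero => simp [revProd, sgn_zero]
  | succ n ih =>
    have h1 := revProd_mul_comm p q c d n n fun i hi => h i n hi (by omega)
    calc revProd c (n + 1) * revProd d (n + 1)
        = c n * (revProd c n * d n) * revProd d n := by simp only [revProd, mul_assoc]
      _ = sgn k (∑ i ∈ Finset.range n, p i * q n) •
            (c n * d n * (revProd c n * revProd d n)) := by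
          rw [h1]; simp only [mul_smul_comm, smul_mul_assoc, mul_assoc]
      _ = _ := by
          rw [ih fun i j hi hj => h i j hi (by omega), Finset.sum_range_succ, sgn_add,
            mul_smul_comm, smul_smul, mul_comm (sgn k _), revProd]

/-- Move an element past an ordered product at the cost of exchanging two adjacent factors. -/
lemma mul_revProd_of_swap (x : E) (c c' : ℕ → E) (s : k) (i n : ℕ) (hn : i + 1 < n)
    (hlo : x * c i = c' (i + 1) * x) (hhi : x * c (i + 1) = c' i * x)
    (hc : ∀ j < n, j ≠ i → j ≠ i + 1 → x * c j = c' j * x)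
    (hs : c' i * c' (i + 1) = s • (c' (i + 1) * c' i)) :
    x * revProd c n = s • (revProd c' n * x) := by
  have below : ∀ m ≤ i, x * revProd c m = revProd c' m * x := by
    intro m hm
    induction m with
    | zero => simp [revProd]
    | succ m ih =>
      rw [revProd, revProd, ← mul_assoc, hc m (by omega) (by omega) (by omega), mul_assoc,
        ih (by omega), mul_assoc]
  induction n with
  | zero => omega
  | succ n ih =>
    rcases Nat.lt_or_ge (i + 1) n with h | h
    · rw [revProd, revProd, ← mul_assoc, hc n (by omega) (by omega) (by omega), mul_assoc,
        ih h fun j hj => hc j (by omega), mul_smul_comm, mul_assoc]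
    · obtain rfl : n = i + 1 := by omega
      calc x * revProd c (i + 1 + 1) = x * c (i + 1) * c i * revProd c i := by
            simp only [revProd, mul_assoc]
        _ = c' i * (x * c i) * revProd c i := by rw [hhi]; simp only [mul_assoc]
        _ = (c' i * c' (i + 1)) * (x * revProd c i) := by rw [hlo]; simp only [mul_assoc]
        -- The two exchanged factors now stand in increasing order; `hs` restores the decreasing
        -- order and produces the scalar `s`.
        _ = _ := by
          rw [hs, below i le_rfl]; simp only [revProd, mul_assoc, smul_mul_assoc]

end OrderedProducts

/-! ### The superalgebra `A^{⊗n}`: homogeneous tensors, its `n` copies of `A`, and its universal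
property. -/

namespace SuperTensorPower

variable {k : Type u} [CommRing k] {A : Type v} [Ring A] [Algebra k A]
  (𝒜 : ZMod 2 → Submodule k A) [GradedAlgebra 𝒜] {n : ℕ}

/-- Brings the sign into the shape in which `revProd_mul_revProd` produces it. -/
lemma koszulSign_eq_range (p q : ℕ → ZMod 2) :
    koszulSign k (fun i : Fin n => p i) (fun i : Fin n => q i) =
      sgn k (∑ j ∈ Finset.range n, ∑ i ∈ Finset.range j, p i * q j) := by
  unfold koszulSign
  congr 1
  rw [Finset.sum_comm,
    ← Fin.sum_univ_eq_sum_range (fun j => ∑ i ∈ Finset.range j, p i * q j)]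
  refine Finset.sum_congr rfl fun j _ => ?_
  simp only [Fin.lt_def]
  rw [Fin.sum_univ_eq_sum_range (fun i => if i < (j : ℕ) then p i * q j else 0),
    ← Finset.sum_filter]
  refine Finset.sum_congr ?_ fun _ _ => rfl
  ext i
  simp only [Finset.mem_filter, Finset.mem_range]
  have := j.2
  omega

lemma proj_of_mem {p q : ZMod 2} {a : A} (ha : a ∈ 𝒜 p) :
    GradedAlgebra.proj 𝒜 q a = if q = p then a else 0 := by
  rw [GradedAlgebra.proj_apply]
  split_ifs with h
  · subst h; exact DirectSum.decompose_of_mem_same 𝒜 ha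
  · exact DirectSum.decompose_of_mem_ne 𝒜 ha (Ne.symm h)

lemma proj_mem (p : ZMod 2) (a : A) : GradedAlgebra.proj 𝒜 p a ∈ 𝒜 p := by
  rw [GradedAlgebra.proj_apply]; exact SetLike.coe_mem _

lemma multiProj_tprod_of_mem {a : Fin n → A} {p : Fin n → ZMod 2} (ha : ∀ i, a i ∈ 𝒜 (p i))
    (q : Fin n → ZMod 2) :
    multiProj 𝒜 n q (PiTensorProduct.tprod k a) =
      if q = p then PiTensorProduct.tprod k a else 0 := by
  rw [multiProj_tprod]
  split_ifs with h
  · subst h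
    congr 1
    ext i
    rw [proj_of_mem 𝒜 (ha i), if_pos rfl]
  · obtain ⟨i, hi⟩ := Function.ne_iff.mp h
    exact (PiTensorProduct.tprod k).map_coord_zero i (by rw [proj_of_mem 𝒜 (ha i), if_neg hi])

lemma tprod_mul_tprod {a b : Fin n → A} {p q : Fin n → ZMod 2} (ha : ∀ i, a i ∈ 𝒜 (p i))
    (hb : ∀ i, b i ∈ 𝒜 (q i)) :
    tprod 𝒜 a * tprod 𝒜 b = koszulSign k p q • tprod 𝒜 (fun i => a i * b i) := by
  change superMul 𝒜 n (PiTensorProduct.tprod k a) (PiTensorProduct.tprod k b) = _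
  rw [superMul_apply]
  simp only [multiProj_tprod_of_mem 𝒜 ha, multiProj_tprod_of_mem 𝒜 hb, ite_mul, zero_mul,
    mul_ite, mul_zero, smul_ite, smul_zero, Finset.sum_ite_eq', Finset.mem_univ, if_true]
  rw [PiTensorProduct.tprod_mul_tprod]
  rfl

lemma superSwap_tprod {a : Fin n → A} {p : Fin n → ZMod 2}
    (ha : ∀ i, a i ∈ 𝒜 (p i)) (i : Fin (n - 1)) :
    superSwap 𝒜 i (tprod 𝒜 a) =
      sgn k (p (lo i) * p (hi i)) • tprod 𝒜 (fun j => a (Equiv.swap (lo i) (hi i) j)) := by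
  change superSwapAux 𝒜 i (PiTensorProduct.tprod k a) = _
  simp only [superSwapAux, LinearMap.sum_apply, LinearMap.smul_apply, LinearMap.comp_apply,
    multiProj_tprod_of_mem 𝒜 ha]
  rw [Finset.sum_eq_single p]
  · simp only [if_true, LinearEquiv.coe_coe, PiTensorProduct.reindex_tprod, Equiv.symm_swap]
    rfl
  · intro q _ hq
    rw [if_neg hq, map_zero, smul_zero]
  · simp

/-- The pure tensors of homogeneous elements span `A^{⊗n}`. -/
lemma induction_on_homogeneous {P : SuperTensorPower 𝒜 n → Prop}
    (tprod : ∀ (p : Fin n → ZMod 2) (a : Fin n → A), (∀ i, a i ∈ 𝒜 (p i)) → P (tprod 𝒜 a))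
    (zero : P 0) (add : ∀ x y, P x → P y → P (x + y)) (smul : ∀ (c : k) x, P x → P (c • x))
    (x : SuperTensorPower 𝒜 n) : P x := by
  -- Any tensor is the sum of its projections `multiProj`, and such a projection turns a pure tensor
  -- into a pure tensor with homogeneous entries.
  have key : ∀ x : ⨂[k] _ : Fin n, A, ∀ p, P (multiProj 𝒜 n p x) := by
    intro x p
    induction x using PiTensorProduct.induction_on with
    | smul_tprod r a =>
      rw [map_smul, multiProj_tprod]
      exact smul r _ (tprod p _ fun i => proj_mem 𝒜 _ _)
    | add x y hx hy => rw [map_add]; exact add _ _ hx hy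
  rw [← sum_multiProj 𝒜 n x]
  exact Finset.sum_induction _ P (fun x y => add x y) zero fun p _ => key x p

lemma linearMap_ext {M : Type*} [AddCommMonoid M] [Module k M]
    {f g : SuperTensorPower 𝒜 n →ₗ[k] M}
    (h : ∀ (p : Fin n → ZMod 2) (a : Fin n → A), (∀ i, a i ∈ 𝒜 (p i)) →
      f (tprod 𝒜 a) = g (tprod 𝒜 a)) : f = g := by
  ext x
  induction x using induction_on_homogeneous 𝒜 with
  | tprod p a ha => exact h p a ha
  | zero => simp
  | add x y hx hy => rw [map_add, map_add, hx, hy]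
  | smul c x hx => rw [map_smul, map_smul, hx]

lemma single_mem_homogeneous (j : Fin n) {p : ZMod 2} {a : A} (ha : a ∈ 𝒜 p)
    (i : Fin n) : (if i = j then a else 1) ∈ 𝒜 (if i = j then p else 0) := by
  split_ifs with h
  · exact ha
  · exact SetLike.GradedOne.one_mem

lemma single_mem_parity (j : Fin n) {p : ZMod 2} {a : A} (ha : a ∈ 𝒜 p) :
    single 𝒜 j a ∈ parity 𝒜 n p :=
  Submodule.subset_span ⟨fun i => if i = j then p else 0, _,
    single_mem_homogeneous 𝒜 j ha, by simp, rfl⟩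

/-- The linear map `a ↦ 1 ⊗ ⋯ ⊗ a ⊗ ⋯ ⊗ 1`, with `a` in the factor `j`. -/
def singleₗ (j : Fin n) : A →ₗ[k] SuperTensorPower 𝒜 n :=
  (PiTensorProduct.tprod k (s := fun _ : Fin n => A)).toLinearMap (fun _ => 1) j

lemma singleₗ_apply (j : Fin n) (a : A) : singleₗ 𝒜 j a = single 𝒜 j a := by
  change PiTensorProduct.tprod k _ = PiTensorProduct.tprod k _
  congr 1
  ext i
  simp [Function.update_apply]

lemma single_mul_single_same (j : Fin n) {p q : ZMod 2} {a b : A} (ha : a ∈ 𝒜 p) (hb : b ∈ 𝒜 q) :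
    single 𝒜 j a * single 𝒜 j b = single 𝒜 j (a * b) := by
  rw [single, single, tprod_mul_tprod 𝒜 (single_mem_homogeneous 𝒜 j ha)
    (single_mem_homogeneous 𝒜 j hb)]
  have h : koszulSign k (fun i => if i = j then p else 0) (fun i => if i = j then q else 0) = 1 := by
    rw [koszulSign, Finset.sum_eq_zero, sgn_zero]
    intro i _
    refine Finset.sum_eq_zero fun l _ => ?_
    split_ifs with h1 h2 h3 <;> simp
    subst h2 h3; exact absurd h1 (lt_irrefl _)
  rw [h, one_smul]
  congr 1
  ext i
  split_ifs <;> simp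

lemma single_one (j : Fin n) : single 𝒜 j (1 : A) = 1 := by
  change PiTensorProduct.tprod k _ = (1 : ⨂[k] _ : Fin n, A)
  rw [PiTensorProduct.one_def]
  congr 1
  ext i
  simp

lemma single_mul_single (i j : Fin n) (hij : i ≠ j) {p q : ZMod 2} {a b : A} (ha : a ∈ 𝒜 p)
    (hb : b ∈ 𝒜 q) :
    single 𝒜 i a * single 𝒜 j b = (if i < j then sgn k (p * q) else 1) •
      tprod 𝒜 (fun l => if l = i then a else if l = j then b else 1) := by
  rw [single, single, tprod_mul_tprod 𝒜 (single_mem_homogeneous 𝒜 i ha)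
    (single_mem_homogeneous 𝒜 j hb)]
  congr 1
  · rw [koszulSign, Finset.sum_eq_single i, Finset.sum_eq_single j]
    · split_ifs <;> simp_all [sgn_zero]
    · intro l _ hl; simp [hl]
    · simp
    · intro l _ hl; simp [hl]
    · simp
  · congr 1
    ext l
    split_ifs with h1 h2 <;> simp_all

/-- Both products are multiples of the same pure tensor. A sign arises only in the order that has
the smaller factor index on the left. -/
lemma single_comm (i j : Fin n) (hij : i ≠ j) {p q : ZMod 2} {a b : A} (ha : a ∈ 𝒜 p)
    (hb : b ∈ 𝒜 q) :
    single 𝒜 i a * single 𝒜 j b = sgn k (p * q) • (single 𝒜 j b * single 𝒜 i a) := by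
  rw [single_mul_single 𝒜 i j hij ha hb, single_mul_single 𝒜 j i hij.symm hb ha, smul_smul]
  congr 1
  · rcases lt_or_gt_of_ne hij with h | h
    · rw [if_pos h, if_neg h.not_gt, mul_one]
    · rw [if_neg h.not_gt, if_pos h, mul_comm q p, sgn_mul_self]
  · congr 1
    ext l
    split_ifs with h1 h2 <;> simp_all

/-- In decreasing order of the factors each new entry lies to the left of all previous ones, so no
entries have to pass each other and no sign appears. Hence the copies of `A` generate `A^{⊗n}`. -/
lemma tprod_eq_revProd {a : Fin n → A} {p : Fin n → ZMod 2} (ha : ∀ i, a i ∈ 𝒜 (p i)) :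
    tprod 𝒜 a = revProd (fun i => if h : i < n then single 𝒜 ⟨i, h⟩ (a ⟨i, h⟩) else 1) n := by
  have key : ∀ m ≤ n, revProd (fun i => if h : i < n then single 𝒜 ⟨i, h⟩ (a ⟨i, h⟩) else 1) m =
      tprod 𝒜 (fun i => if (i : ℕ) < m then a i else 1) := by
    intro m hm
    induction m with
    | zero =>
      rw [revProd]
      change (1 : ⨂[k] _ : Fin n, A) = PiTensorProduct.tprod k _
      rw [PiTensorProduct.one_def]
      congr 1
    | succ m ih =>
      have hmem : ∀ i : Fin n,
          (if (i : ℕ) < m then a i else 1) ∈ 𝒜 (if (i : ℕ) < m then p i else 0) := by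
        intro i
        split_ifs with h
        · exact ha i
        · exact SetLike.GradedOne.one_mem
      rw [revProd, ih (by omega), dif_pos (by omega), single,
        tprod_mul_tprod 𝒜 (single_mem_homogeneous 𝒜 ⟨m, hm⟩ (ha _)) hmem]
      have h : koszulSign k (fun i => if i = (⟨m, hm⟩ : Fin n) then p ⟨m, hm⟩ else 0)
          (fun i => if (i : ℕ) < m then p i else 0) = 1 := by
        rw [koszulSign, Finset.sum_eq_zero, sgn_zero]
        intro i _
        refine Finset.sum_eq_zero fun l _ => ?_
        split_ifs with h1 h2 h3 <;> simp
        simp only [Fin.lt_def, Fin.ext_iff] at h1 h2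
        omega
      rw [h, one_smul]
      congr 1
      ext i
      simp only [Fin.ext_iff]
      by_cases h1 : (i : ℕ) = m
      · obtain rfl : i = ⟨m, hm⟩ := Fin.ext h1
        simp
      · rw [if_neg h1, one_mul]
        exact if_congr (by omega) rfl rfl
  rw [key n le_rfl]
  congr 1
  ext i
  rw [if_pos i.2]

/-- The linear map underlying `SuperTensorPower.lift`. -/
def liftₗ {E : Type*} [Ring E] [Algebra k E] (φ : Fin n → A →ₐ[k] E) :
    SuperTensorPower 𝒜 n →ₗ[k] E :=
  -- `MultilinearMap.mkPiAlgebraFin` multiplies in increasing order of the index, while the factors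
  -- are numbered from right to left; hence the reversal of both the maps and the arguments.
  PiTensorProduct.lift
    (((MultilinearMap.mkPiAlgebraFin k n E).compLinearMap
      (fun i => (φ (Fin.rev i)).toLinearMap)).domDomCongr Fin.revPerm)

lemma liftₗ_tprod {E : Type*} [Ring E] [Algebra k E] (φ : Fin n → A →ₐ[k] E)
    (a : Fin n → A) :
    liftₗ 𝒜 φ (tprod 𝒜 a) =
      revProd (fun i => if h : i < n then φ ⟨i, h⟩ (a ⟨i, h⟩) else 1) n := by
  refine (PiTensorProduct.lift.tprod _).trans ?_
  rw [revProd_eq_prod_ofFn, MultilinearMap.domDomCongr_apply, MultilinearMap.compLinearMap_apply,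
    MultilinearMap.mkPiAlgebraFin_apply]
  congr 2
  ext i
  rw [dif_pos (by have := i.2; omega)]
  rfl

/-- The algebra homomorphism out of `A^{⊗n}` given by homomorphisms out of the factors whose images
supercommute. -/
def lift {E : Type*} [Ring E] [Algebra k E] (φ : Fin n → A →ₐ[k] E)
    (hφ : ∀ i j, i < j → ∀ p q, ∀ a ∈ 𝒜 p, ∀ b ∈ 𝒜 q,
      φ i a * φ j b = sgn k (p * q) • (φ j b * φ i a)) :
    SuperTensorPower 𝒜 n →ₐ[k] E :=
  AlgHom.ofLinearMap (liftₗ 𝒜 φ)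
    (by
      have h : (1 : SuperTensorPower 𝒜 n) = tprod 𝒜 (fun _ => 1) :=
        PiTensorProduct.one_def
      rw [h, liftₗ_tprod]
      have : ∀ m, revProd (fun i => if h : i < n then φ ⟨i, h⟩ (1 : A) else 1) m = 1 := by
        intro m
        induction m with
        | zero => rfl
        | succ m ih => rw [revProd, ih]; simp
      exact this n)
    (by
      -- Multiplicativity is an equality of bilinear maps, so it can be tested on homogeneous pure
      -- tensors, where the sign rule is explicit.
      suffices h : (LinearMap.mul k (SuperTensorPower 𝒜 n)).compr₂ (liftₗ 𝒜 φ) =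
          (LinearMap.mul k E).compl₁₂ (liftₗ 𝒜 φ) (liftₗ 𝒜 φ) by
        intro x y
        exact LinearMap.congr_fun₂ h x y
      refine linearMap_ext 𝒜 fun p a ha => linearMap_ext 𝒜 fun q b hb => ?_
      simp only [LinearMap.compr₂_apply, LinearMap.mul_apply', LinearMap.compl₁₂_apply]
      rw [tprod_mul_tprod 𝒜 ha hb, map_smul]
      simp only [liftₗ_tprod]
      let p' : ℕ → ZMod 2 := fun i => if h : i < n then p ⟨i, h⟩ else 0
      let q' : ℕ → ZMod 2 := fun i => if h : i < n then q ⟨i, h⟩ else 0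
      rw [revProd_mul_revProd (k := k) p' q']
      · rw [← koszulSign_eq_range]
        congr 1
        · congr 1 <;> ext i <;> simp [p', q']
        · refine revProd_congr n fun i hi => ?_
          simp only [dif_pos hi, map_mul]
      · intro i j hij hj
        have hi : i < n := by omega
        simp only [p', q', dif_pos hi, dif_pos hj]
        exact hφ _ _ hij _ _ _ (ha _) _ (hb _))

lemma lift_tprod {E : Type*} [Ring E] [Algebra k E] (φ : Fin n → A →ₐ[k] E)
    (hφ : ∀ i j, i < j → ∀ p q, ∀ a ∈ 𝒜 p, ∀ b ∈ 𝒜 q,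
      φ i a * φ j b = sgn k (p * q) • (φ j b * φ i a)) (a : Fin n → A) :
    lift 𝒜 φ hφ (tprod 𝒜 a) =
      revProd (fun i => if h : i < n then φ ⟨i, h⟩ (a ⟨i, h⟩) else 1) n :=
  liftₗ_tprod 𝒜 φ a

lemma lift_single {E : Type*} [Ring E] [Algebra k E] (φ : Fin n → A →ₐ[k] E)
    (hφ : ∀ i j, i < j → ∀ p q, ∀ a ∈ 𝒜 p, ∀ b ∈ 𝒜 q,
      φ i a * φ j b = sgn k (p * q) • (φ j b * φ i a)) (j : Fin n) (a : A) :
    lift 𝒜 φ hφ (single 𝒜 j a) = φ j a := by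
  rw [single, lift_tprod, revProd_eq_single _ j n j.2]
  · simp
  · intro i hi hij
    rw [dif_pos hi, if_neg (by simpa [Fin.ext_iff] using hij), map_one]

/-- Algebra homomorphisms out of `A^{⊗n}` that agree on the factors are equal. -/
lemma algHom_ext {E : Type*} [Ring E] [Algebra k E] {f g : SuperTensorPower 𝒜 n →ₐ[k] E}
    (h : ∀ (j : Fin n) (p : ZMod 2), ∀ a ∈ 𝒜 p, f (single 𝒜 j a) = g (single 𝒜 j a)) : f = g := by
  suffices h : f.toLinearMap = g.toLinearMap from AlgHom.toLinearMap_injective h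
  refine linearMap_ext 𝒜 fun p a ha => ?_
  simp only [AlgHom.toLinearMap_apply]
  rw [tprod_eq_revProd 𝒜 ha, map_revProd, map_revProd]
  refine revProd_congr n fun i hi => ?_
  simp only [dif_pos hi]
  exact h _ _ _ (ha _)

/-- One of the two exchanged entries is `1`, hence even, and the sign of the exchange disappears.
Together with the next two lemmas this specializes the relation for `u_i` and `A^{⊗n}` to single
tokens. -/
lemma superSwap_single_lo (i : Fin (n - 1)) {p : ZMod 2} {a : A} (ha : a ∈ 𝒜 p) :
    superSwap 𝒜 i (single 𝒜 (lo i) a) = single 𝒜 (hi i) a := by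
  have hne : hi i ≠ lo i := by simp [lo, hi]
  rw [single, superSwap_tprod 𝒜 (single_mem_homogeneous 𝒜 _ ha), if_neg hne, mul_zero, sgn_zero,
    one_smul, single]
  congr 1
  ext j
  exact if_congr (by rw [Equiv.swap_apply_eq_iff, Equiv.swap_apply_left]) rfl rfl

lemma superSwap_single_hi (i : Fin (n - 1)) {p : ZMod 2} {a : A} (ha : a ∈ 𝒜 p) :
    superSwap 𝒜 i (single 𝒜 (hi i) a) = single 𝒜 (lo i) a := by
  have hne : lo i ≠ hi i := by simp [lo, hi]
  rw [single, superSwap_tprod 𝒜 (single_mem_homogeneous 𝒜 _ ha), if_neg hne, zero_mul, sgn_zero,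
    one_smul, single]
  congr 1
  ext j
  exact if_congr (by rw [Equiv.swap_apply_eq_iff, Equiv.swap_apply_right]) rfl rfl

lemma superSwap_single_of_ne (i : Fin (n - 1)) (j : Fin n) (h1 : j ≠ lo i) (h2 : j ≠ hi i)
    {p : ZMod 2} {a : A} (ha : a ∈ 𝒜 p) :
    superSwap 𝒜 i (single 𝒜 j a) = single 𝒜 j a := by
  rw [single, superSwap_tprod 𝒜 (single_mem_homogeneous 𝒜 _ ha), if_neg h1.symm, zero_mul,
    sgn_zero, one_smul]
  congr 1
  ext l
  exact if_congr (by rw [Equiv.swap_apply_eq_iff, Equiv.swap_apply_of_ne_of_ne h1 h2]) rfl rfl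

end SuperTensorPower

/-- The left entry of the teleporter sits in the higher factor, so the product in this order carries
no Koszul sign. In this form homomorphisms can be applied to `τ_i` token by token. -/
lemma SymmetricFrobenius.tau_eq {k : Type u} [CommRing k] {A : Type v} [Ring A] [Algebra k A]
    {𝒜 : ZMod 2 → Submodule k A} [GradedAlgebra 𝒜] {ι : Type w} [Fintype ι] [DecidableEq ι]
    (F : SymmetricFrobenius 𝒜 ι) {n : ℕ} (i : Fin (n - 1)) :
    F.tau i = ∑ b : ι, sgn k (F.σ * F.deg b) •
      (SuperTensorPower.single 𝒜 (hi i) (F.basis b) *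
        SuperTensorPower.single 𝒜 (lo i) (F.dual b)) := by
  refine Finset.sum_congr rfl fun b _ => ?_
  rw [SuperTensorPower.single_mul_single 𝒜 _ _ (by simp [lo, hi]) (F.basis_mem b) (F.dual_mem b),
    if_neg (by simp [lo, hi, Fin.lt_def]), one_smul]

/-! ### Supercommuting elements of an algebra. -/

section SuperCommute

variable {k : Type u} [CommRing k] {E : Type*} [Ring E] [Algebra k E]

/-- Elements of parities `p` and `q` supercommute. -/
def SuperCommute (k : Type u) [CommRing k] {E : Type*} [Ring E] [Algebra k E] (p q : ZMod 2)
    (a b : E) : Prop :=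
  a * b = sgn k (p * q) • (b * a)

namespace SuperCommute

variable {p q r : ZMod 2} {a b c : E}

lemma symm (h : SuperCommute k p q a b) : SuperCommute k q p b a := by
  unfold SuperCommute at *
  rw [h, smul_smul, mul_comm q p, sgn_mul_self, one_smul]

lemma one_right (a : E) : SuperCommute k p 0 a 1 := by
  simp [SuperCommute, sgn_zero]

lemma zero_right (a : E) : SuperCommute k p q a 0 := by
  simp [SuperCommute]

lemma mul_right (hb : SuperCommute k p q a b) (hc : SuperCommute k p r a c) :
    SuperCommute k p (q + r) a (b * c) := by
  unfold SuperCommute at *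
  rw [← mul_assoc, hb, smul_mul_assoc, mul_assoc, hc, mul_smul_comm, smul_smul, mul_add, sgn_add,
    mul_assoc]

lemma add_right (hb : SuperCommute k p q a b) (hc : SuperCommute k p q a c) :
    SuperCommute k p q a (b + c) := by
  unfold SuperCommute at *
  rw [mul_add, add_mul, hb, hc, smul_add]

lemma smul_right (t : k) (hb : SuperCommute k p q a b) : SuperCommute k p q a (t • b) := by
  unfold SuperCommute at *
  rw [mul_smul_comm, smul_mul_assoc, hb, smul_comm]

end SuperCommute

end SuperCommute

/-! ### The presented algebra and the evaluation of formal expressions in it. -/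

section NilHecke

variable {k : Type u} [CommRing k] {A : Type v} [Ring A] [Algebra k A]
variable {𝒜 : ZMod 2 → Submodule k A} [GradedAlgebra 𝒜] {ι : Type w} [Fintype ι] [DecidableEq ι]

namespace PresAlg

variable (F : SymmetricFrobenius 𝒜 ι) {n : ℕ}

/-- The map from `A^{⊗n}` to the presented algebra. -/
def tensHom (n : ℕ) : SuperTensorPower 𝒜 n →ₐ[k] PresAlg F n :=
  (RingQuot.mkAlgHom k (PresRel F n)).comp
    (LinearAlgebra.FreeProduct.ι k (NHFactor 𝒜 n) true : NHFactor 𝒜 n true →ₐ[k] NHFree 𝒜 n)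

lemma tensHom_apply (a : SuperTensorPower 𝒜 n) : tensHom F n a = tens F a := rfl

lemma u_sq (i : Fin (n - 1)) : u F i * u F i = 0 := by
  simpa [u] using RingQuot.mkAlgHom_rel k (PresRel.u_sq (F := F) i)

lemma u_comm (i j : Fin (n - 1)) (h : (i : ℕ) + 1 < j ∨ (j : ℕ) + 1 < i) :
    u F i * u F j = u F j * u F i := by
  simpa [u] using RingQuot.mkAlgHom_rel k (PresRel.u_comm (F := F) i j h)

lemma u_braid (i j : Fin (n - 1)) (h : (j : ℕ) = i + 1) :
    u F i * u F j * u F i = u F j * u F i * u F j := by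
  simpa [u] using RingQuot.mkAlgHom_rel k (PresRel.u_braid (F := F) i j h)

lemma u_tens (i : Fin (n - 1)) (a : SuperTensorPower 𝒜 n) :
    u F i * tens F a = tens F (superSwap 𝒜 i a) * u F i := by
  simpa [u, tens] using RingQuot.mkAlgHom_rel k (PresRel.u_tens (F := F) i a)

lemma x_comm (i j : Fin n) (h : i ≠ j) : x F i * x F j = sgn k F.σ • (x F j * x F i) := by
  simpa [x] using RingQuot.mkAlgHom_rel k (PresRel.x_comm (F := F) i j h)

lemma tens_x (p : ZMod 2) (a : SuperTensorPower 𝒜 n) (j : Fin n)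
    (ha : a ∈ SuperTensorPower.parity 𝒜 n p) :
    tens F a * x F j = sgn k (F.σ * p) • (x F j * tens F a) := by
  simpa [x, tens] using RingQuot.mkAlgHom_rel k (PresRel.tens_x (F := F) p a j ha)

lemma x_u_comm (i : Fin (n - 1)) (j : Fin n) (h1 : j ≠ lo i) (h2 : j ≠ hi i) :
    x F j * u F i = u F i * x F j := by
  simpa [x, u] using RingQuot.mkAlgHom_rel k (PresRel.x_u_comm (F := F) i j h1 h2)

lemma u_x (i : Fin (n - 1)) :
    u F i * x F (hi i) = x F (lo i) * u F i + tens F (F.tau i) := by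
  simpa [x, u, tens] using RingQuot.mkAlgHom_rel k (PresRel.u_x (F := F) i)

lemma x_u (i : Fin (n - 1)) :
    x F (hi i) * u F i = u F i * x F (lo i) + sgn k F.σ • tens F (F.tau i) := by
  simpa [x, u, tens] using RingQuot.mkAlgHom_rel k (PresRel.x_u (F := F) i)

variable {F} in
lemma IsWord.mul {p q : ZMod 2} {y z : PresAlg F n} (hy : IsWord F n p y) (hz : IsWord F n q z) :
    IsWord F n (p + q) (y * z) := by
  induction hy with
  | one => simpa using hz
  | tens_mul a y ha _ ih => rw [add_assoc, mul_assoc]; exact .tens_mul a _ ha ih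
  | u_mul i y _ ih => rw [mul_assoc]; exact .u_mul i _ ih
  | x_mul j y _ ih => rw [add_assoc, mul_assoc]; exact .x_mul j _ ih

variable {F} in
lemma mul_mem_parity {p q : ZMod 2} {y z : PresAlg F n} (hy : y ∈ parity F n p)
    (hz : z ∈ parity F n q) : y * z ∈ parity F n (p + q) := by
  have h := Submodule.mul_mem_mul hy hz
  rw [parity, parity, Submodule.span_mul_span] at h
  refine Submodule.span_mono ?_ h
  rintro _ ⟨y, hy, z, hz, rfl⟩
  exact hy.mul hz

lemma u_mem_parity (i : Fin (n - 1)) : u F i ∈ parity F n 0 :=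
  Submodule.subset_span (by simpa using IsWord.u_mul i 1 IsWord.one)

lemma x_mem_parity (j : Fin n) : x F j ∈ parity F n F.σ :=
  Submodule.subset_span (by simpa using IsWord.x_mul j 1 IsWord.one)

lemma tens_mem_parity {p : ZMod 2} {a : SuperTensorPower 𝒜 n}
    (ha : a ∈ SuperTensorPower.parity 𝒜 n p) : tens F a ∈ parity F n p :=
  Submodule.subset_span (by simpa using IsWord.tens_mul a 1 ha IsWord.one)

/-- The value of a generating morphism whose rightmost strand is the strand `r`. -/
def evalGen (n : ℕ) : NHGen 𝒜 → ℕ → PresAlg F n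
  | .cross, r => if h : r < n - 1 then u F ⟨r, h⟩ else 0
  | .dot, r => if h : r < n then x F ⟨r, h⟩ else 0
  | .token _ a, r => if h : r < n then tens F (SuperTensorPower.single 𝒜 ⟨r, h⟩ (a : A)) else 0

/-- The value of an expression whose rightmost strand is the strand `r`. -/
def eval (N : ℕ) : ∀ {m n : ℕ} {p : ZMod 2}, Diagram k (NHSig F) m n p → ℕ → PresAlg F N
  | _, _, _, .gen g, r => evalGen F N g r
  | _, _, _, .ident _, _ => 1
  | _, _, _, .comp f g, r => eval N f r * eval N g r
  | _, _, _, .tens (m' := m') f g, r => eval N f (r + m') * eval N g r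
  | _, _, _, .zero _ _ _, _ => 0
  | _, _, _, .add f g, r => eval N f r + eval N g r
  | _, _, _, .smul c f, r => c • eval N f r

section

variable {N : ℕ} {l m n m' n' : ℕ} {p q : ZMod 2}

lemma eval_gen (g : (NHSig F).Gen) (r : ℕ) :
    eval F N (Diagram.gen (k := k) (S := NHSig F) g) r = evalGen F N g r := rfl

lemma eval_ident (n r : ℕ) : eval F N (Diagram.ident n) r = 1 := rfl

lemma eval_comp (f : Diagram k (NHSig F) m n p) (g : Diagram k (NHSig F) l m q) (r : ℕ) :
    eval F N (Diagram.comp f g) r = eval F N f r * eval F N g r := rfl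

lemma eval_tens (f : Diagram k (NHSig F) m n p) (g : Diagram k (NHSig F) m' n' q) (r : ℕ) :
    eval F N (Diagram.tens f g) r = eval F N f (r + m') * eval F N g r := rfl

lemma eval_zero (r : ℕ) : eval F N (Diagram.zero m n p) r = 0 := rfl

lemma eval_add (f g : Diagram k (NHSig F) m n p) (r : ℕ) :
    eval F N (Diagram.add f g) r = eval F N f r + eval F N g r := rfl

lemma eval_smul (c : k) (f : Diagram k (NHSig F) m n p) (r : ℕ) :
    eval F N (Diagram.smul c f) r = c • eval F N f r := rfl

lemma eval_cast {p' : ZMod 2} (hm : m = m') (hn : n = n') (hp : p = p')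
    (f : Diagram k (NHSig F) m n p) (r : ℕ) :
    eval F N (Diagram.cast hm hn hp f) r = eval F N f r := by
  subst hm hn hp; rfl

lemma eval_sum (L : List (Diagram k (NHSig F) m n p)) (r : ℕ) :
    eval F N (Diagram.sum L) r = (L.map fun f => eval F N f r).sum := by
  induction L with
  | nil => rfl
  | cons f L ih => rw [List.map_cons, List.sum_cons, ← ih]; rfl

lemma eval_cross {r : ℕ} (h : r < N - 1) : eval F N (cross F) r = u F ⟨r, h⟩ :=
  dif_pos h

lemma eval_dot {r : ℕ} (h : r < N) : eval F N (dot F) r = x F ⟨r, h⟩ :=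
  dif_pos h

lemma eval_token {r : ℕ} (h : r < N) (a : 𝒜 p) :
    eval F N (token F a) r = tens F (SuperTensorPower.single 𝒜 ⟨r, h⟩ (a : A)) :=
  dif_pos h

/-- No generating morphism changes the number of strands. A composite or tensor product that does so
has a factor that does so, and that factor makes the product vanish. -/
lemma eval_eq_zero (f : Diagram k (NHSig F) m n p) (h : m ≠ n) (r : ℕ) : eval F N f r = 0 := by
  induction f generalizing r with
  | gen g => cases g <;> exact absurd rfl h
  | ident n => exact absurd rfl h
  | @comp l m n p q f g ihf ihg =>
    rw [eval_comp]
    by_cases hm : l = m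
    · rw [ihf (by omega), zero_mul]
    · rw [ihg hm, mul_zero]
  | @tens m n m' n' p q f g ihf ihg =>
    rw [eval_tens]
    by_cases hm : m = n
    · rw [ihg (by omega), mul_zero]
    · rw [ihf hm, zero_mul]
  | zero m n p => rfl
  | add f g ihf ihg => rw [eval_add, ihf h, ihg h, add_zero]
  | smul c f ih => rw [eval_smul, ih h, smul_zero]

/-- Supercommutation with `y` passes to products and linear combinations. The bounds `a` and `b`
confine the expression to a window of strands, so that the hypothesis is only needed for generators
inside it. -/
lemma superCommute_eval_of_gen {y : PresAlg F N} {a b : ℕ}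
    (h : ∀ (g : NHGen 𝒜) (r : ℕ), a ≤ r → r + (NHSig F).src g ≤ b →
      SuperCommute k p ((NHSig F).par g) y (evalGen F N g r))
    (g : Diagram k (NHSig F) m n q) (r : ℕ) (ha : a ≤ r) (hb : r + m ≤ b) :
    SuperCommute k p q y (eval F N g r) := by
  induction g generalizing r with
  | gen g => exact h g r ha hb
  | ident n => exact SuperCommute.one_right _
  | @comp l m n p q f g ihf ihg =>
    -- The window bounds the source `l` only, so it says nothing about `f` unless `l = m`; in the
    -- other case the value of `g` is zero.
    rw [eval_comp]
    by_cases hm : l = m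
    · subst hm
      exact (ihf r ha hb).mul_right (ihg r ha hb)
    · rw [eval_eq_zero F g hm, mul_zero]
      exact SuperCommute.zero_right _
  | tens f g ihf ihg =>
    exact (ihf _ (by omega) (by omega)).mul_right (ihg _ ha (by omega))
  | zero m n p => exact SuperCommute.zero_right _
  | add f g ihf ihg => exact (ihf r ha hb).add_right (ihg r ha hb)
  | smul c f ih => exact (ih r ha hb).smul_right c

lemma superCommute_u_x (i : Fin (n - 1)) (j : Fin n) (h1 : j ≠ lo i) (h2 : j ≠ hi i) :
    SuperCommute k 0 p (u F i) (x F j) := by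
  rw [SuperCommute, zero_mul, sgn_zero, one_smul, x_u_comm F i j h1 h2]

lemma superCommute_u_single (i : Fin (n - 1)) (j : Fin n) (h1 : j ≠ lo i) (h2 : j ≠ hi i)
    (a : 𝒜 p) :
    SuperCommute k 0 p (u F i) (tens F (SuperTensorPower.single 𝒜 j (a : A))) := by
  rw [SuperCommute, zero_mul, sgn_zero, one_smul, u_tens,
    SuperTensorPower.superSwap_single_of_ne 𝒜 i j h1 h2 a.2]

lemma superCommute_tens_x {a : SuperTensorPower 𝒜 n} (ha : a ∈ SuperTensorPower.parity 𝒜 n p)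
    (j : Fin n) : SuperCommute k p F.σ (tens F a) (x F j) := by
  rw [SuperCommute, mul_comm, tens_x F p a j ha]

lemma superCommute_single (i j : Fin n) (hij : i ≠ j) (a : 𝒜 p) (b : 𝒜 q) :
    SuperCommute k p q (tens F (SuperTensorPower.single 𝒜 i (a : A)))
      (tens F (SuperTensorPower.single 𝒜 j (b : A))) := by
  rw [SuperCommute, ← tensHom_apply, ← tensHom_apply, ← map_mul, ← map_mul, ← map_smul,
    SuperTensorPower.single_comm 𝒜 i j hij a.2 b.2]

/-- These nine cases are where the far commutation relations of the presentation are used; they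
correspond to the interchange law for two generating morphisms. -/
lemma superCommute_evalGen (f g : NHGen 𝒜) (r s : ℕ) (h : r + (NHSig F).src g ≤ s)
    (hs : s + (NHSig F).src f ≤ N) :
    SuperCommute k ((NHSig F).par f) ((NHSig F).par g) (evalGen F N f s) (evalGen F N g r) := by
  cases f with
  | cross =>
    cases g with
    | cross =>
      change r + 2 ≤ s at h
      change s + 2 ≤ N at hs
      change SuperCommute k 0 0 _ _
      rw [evalGen, evalGen, dif_pos (by omega), dif_pos (by omega), SuperCommute, zero_mul,
        sgn_zero, one_smul, u_comm]
      exact Or.inr h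
    | dot =>
      change r + 1 ≤ s at h
      change s + 2 ≤ N at hs
      rw [evalGen, evalGen, dif_pos (by omega), dif_pos (by omega)]
      exact superCommute_u_x F _ _ (by simp only [lo, ne_eq, Fin.mk.injEq]; omega)
        (by simp only [hi, ne_eq, Fin.mk.injEq]; omega)
    | token p a =>
      change r + 1 ≤ s at h
      change s + 2 ≤ N at hs
      rw [evalGen, evalGen, dif_pos (by omega), dif_pos (by omega)]
      exact superCommute_u_single F _ _ (by simp only [lo, ne_eq, Fin.mk.injEq]; omega)
        (by simp only [hi, ne_eq, Fin.mk.injEq]; omega) a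
  | dot =>
    cases g with
    | cross =>
      change r + 2 ≤ s at h
      change s + 1 ≤ N at hs
      rw [evalGen, evalGen, dif_pos (by omega), dif_pos (by omega)]
      exact (superCommute_u_x F _ _ (by simp only [lo, ne_eq, Fin.mk.injEq]; omega)
        (by simp only [hi, ne_eq, Fin.mk.injEq]; omega)).symm
    | dot =>
      change r + 1 ≤ s at h
      change s + 1 ≤ N at hs
      change SuperCommute k F.σ F.σ _ _
      rw [evalGen, evalGen, dif_pos (by omega), dif_pos (by omega), SuperCommute,
        sgn_sq_arg, x_comm]
      simp only [ne_eq, Fin.mk.injEq]; omega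
    | token p a =>
      change r + 1 ≤ s at h
      change s + 1 ≤ N at hs
      rw [evalGen, evalGen, dif_pos (by omega), dif_pos (by omega)]
      exact (superCommute_tens_x F (SuperTensorPower.single_mem_parity 𝒜 _ a.2) _).symm
  | token p a =>
    cases g with
    | cross =>
      change r + 2 ≤ s at h
      change s + 1 ≤ N at hs
      rw [evalGen, evalGen, dif_pos (by omega), dif_pos (by omega)]
      exact (superCommute_u_single F _ _ (by simp only [lo, ne_eq, Fin.mk.injEq]; omega)
        (by simp only [hi, ne_eq, Fin.mk.injEq]; omega) a).symm
    | dot =>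
      change r + 1 ≤ s at h
      change s + 1 ≤ N at hs
      rw [evalGen, evalGen, dif_pos (by omega), dif_pos (by omega)]
      exact superCommute_tens_x F (SuperTensorPower.single_mem_parity 𝒜 _ a.2) _
    | token q b =>
      change r + 1 ≤ s at h
      change s + 1 ≤ N at hs
      rw [evalGen, evalGen, dif_pos (by omega), dif_pos (by omega)]
      exact superCommute_single F _ _ (by simp only [ne_eq, Fin.mk.injEq]; omega) a b

/-- Expressions on disjoint sets of strands supercommute. -/
lemma superCommute_eval (f : Diagram k (NHSig F) m n p) (g : Diagram k (NHSig F) m' n' q)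
    (r s : ℕ) (h : r + m' ≤ s) (hs : s + m ≤ N) :
    SuperCommute k p q (eval F N f s) (eval F N g r) := by
  -- Two reductions to generators: of `g`, with the value of `f` fixed, and then of `f`, against one
  -- fixed generator. Symmetry of supercommutation switches between the two.
  refine superCommute_eval_of_gen F (a := 0) (b := s) (fun g r _ hr => ?_) g r (by omega) h
  refine (superCommute_eval_of_gen F (a := s) (b := N) (fun f s' hs' hf => ?_) f s le_rfl hs).symm
  exact (superCommute_evalGen F f g r s' (by omega) hf).symm

lemma eval_mem_parity (f : Diagram k (NHSig F) m n p) (r : ℕ) :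
    eval F N f r ∈ parity F N p := by
  induction f generalizing r with
  | gen g =>
    rw [eval_gen]
    cases g with
    | cross =>
      rw [evalGen]; split_ifs
      exacts [u_mem_parity F _, zero_mem _]
    | dot =>
      rw [evalGen]; split_ifs
      exacts [x_mem_parity F _, zero_mem _]
    | token p a =>
      rw [evalGen]; split_ifs
      exacts [tens_mem_parity F (SuperTensorPower.single_mem_parity 𝒜 _ a.2), zero_mem _]
  | ident n => exact Submodule.subset_span IsWord.one
  | comp f g ihf ihg => exact mul_mem_parity (ihf r) (ihg r)
  | tens f g ihf ihg => exact mul_mem_parity (ihf _) (ihg r)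
  | zero m n p => exact zero_mem _
  | add f g ihf ihg => exact add_mem (ihf r) (ihg r)
  | smul c f ih => exact Submodule.smul_mem _ c (ih r)

end

end PresAlg

end NilHecke

/-! ### Invariance of the evaluation under the relations of the category. -/

section NilHecke

variable {k : Type u} [CommRing k] {A : Type v} [Ring A] [Algebra k A]
variable {𝒜 : ZMod 2 → Submodule k A} [GradedAlgebra 𝒜] {ι : Type w} [Fintype ι] [DecidableEq ι]

/-- Since `Rel` links expressions over different indices, bounds on the number of strands must be
carried from one side to the other; this is also what makes chains of relations usable. -/
lemma Diagram.Rel.index_eq {S : Signature.{v}} {R : Diagram.Relations k S} {m n m' n' : ℕ}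
    {p p' : ZMod 2} {f : Diagram k S m n p} {g : Diagram k S m' n' p'} (h : Diagram.Rel R f g) :
    m = m' ∧ n = n' ∧ p = p' := by
  induction h <;> refine ⟨?_, ?_, ?_⟩ <;>
    first | rfl | omega | assumption | simp_all | abel

namespace PresAlg

variable (F : SymmetricFrobenius 𝒜 ι) {N : ℕ}

lemma tens_single_mul (j : Fin N) {p q : ZMod 2} (a : 𝒜 p) (b : 𝒜 q) :
    tens F (SuperTensorPower.single 𝒜 j (a : A)) * tens F (SuperTensorPower.single 𝒜 j (b : A)) =
      tens F (SuperTensorPower.single 𝒜 j (a * b : A)) := by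
  rw [← tensHom_apply, ← tensHom_apply, ← map_mul,
    SuperTensorPower.single_mul_single_same 𝒜 j a.2 b.2]
  rfl

lemma eval_teleporter {r : ℕ} (h : r < N - 1) :
    eval F N (teleporter F) r = tens F (F.tau ⟨r, h⟩) := by
  rw [teleporter, eval_sum, List.map_map, Finset.sum_map_toList, F.tau_eq, ← tensHom_apply,
    map_sum]
  refine Finset.sum_congr rfl fun b _ => ?_
  rw [map_smul, map_mul, Function.comp_apply, eval_smul, eval_cast, eval_tens,
    eval_token F (show r + 1 < N by omega), eval_token F (show r < N by omega)]
  rfl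

/-- The bound `hr` cannot be dropped: a generator beyond the `N` strands has the default value `0`
while identities have value `1`, which would break `token_one`. Within the bound, each relation
becomes one of the presentation or a property of `A^{⊗N}`. -/
lemma eval_relations {m n : ℕ} {p q : ZMod 2} {f : Diagram k (NHSig F) m n p}
    {g : Diagram k (NHSig F) m n q} (h : NHRel F f g) (r : ℕ) (hr : r + m ≤ N) :
    eval F N f r = eval F N g r := by
  cases h with
  | token_one =>
    rw [eval_token F hr, eval_ident, SuperTensorPower.single_one, ← tensHom_apply, map_one]
  | token_linear c d a b =>
    rw [eval_add, eval_smul, eval_smul, eval_token F hr, eval_token F hr, eval_token F hr]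
    simp only [← tensHom_apply, ← SuperTensorPower.singleₗ_apply, ← map_smul, ← map_add]
    rfl
  | token_mul a b =>
    rw [eval_comp, eval_token F hr, eval_token F hr, eval_token F hr, tens_single_mul]
  | cross_cross =>
    rw [eval_comp, eval_cross F (by omega), u_sq, eval_zero]
  | braid =>
    simp only [eval_comp, crossLeft, crossRight, eval_cast, eval_tens, eval_ident, one_mul,
      mul_one, eval_cross F (show r < N - 1 by omega), eval_cross F (show r + 1 < N - 1 by omega),
      ← mul_assoc]
    exact (u_braid F ⟨r, by omega⟩ ⟨r + 1, by omega⟩ rfl).symm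
  | cross_token_left a =>
    simp only [eval_comp, eval_tens, eval_ident, mul_one, one_mul,
      eval_cross F (show r < N - 1 by omega), eval_token F (show r + 1 < N by omega),
      eval_token F (show r < N by omega)]
    rw [u_tens]
    exact congrArg (fun y => tens F y * _) (SuperTensorPower.superSwap_single_hi 𝒜 ⟨r, _⟩ a.2)
  | cross_token_right a =>
    simp only [eval_comp, eval_tens, eval_ident, mul_one, one_mul,
      eval_cross F (show r < N - 1 by omega), eval_token F (show r + 1 < N by omega),
      eval_token F (show r < N by omega)]
    rw [u_tens]
    exact congrArg (fun y => tens F y * _) (SuperTensorPower.superSwap_single_lo 𝒜 ⟨r, _⟩ a.2)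
  | cross_dot_left =>
    simp only [eval_comp, eval_tens, eval_ident, mul_one, one_mul, eval_add, eval_cast,
      eval_cross F (show r < N - 1 by omega), eval_dot F (show r + 1 < N by omega),
      eval_dot F (show r < N by omega), eval_teleporter F (show r < N - 1 by omega)]
    exact u_x F ⟨r, _⟩
  | dot_cross_left =>
    simp only [eval_comp, eval_tens, eval_ident, mul_one, one_mul, eval_add, eval_cast,
      eval_smul, eval_cross F (show r < N - 1 by omega), eval_dot F (show r + 1 < N by omega),
      eval_dot F (show r < N by omega), eval_teleporter F (show r < N - 1 by omega)]
    exact x_u F ⟨r, _⟩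
  | token_dot a =>
    rw [eval_comp, eval_smul, eval_comp, eval_token F hr, eval_dot F hr]
    exact tens_x F _ _ _ (SuperTensorPower.single_mem_parity 𝒜 _ a.2)

/-- The evaluation is compatible with the congruence generated by the defining relations. -/
lemma eval_eq_of_rel {m n m' n' : ℕ} {p p' : ZMod 2} {f : Diagram k (NHSig F) m n p}
    {g : Diagram k (NHSig F) m' n' p'} (h : Diagram.Rel (NHRel F) f g) (r : ℕ) (hr : r + m ≤ N) :
    eval F N f r = eval F N g r := by
  induction h generalizing r with
  | of f g _ h => exact eval_relations F h r hr
  | refl f => rfl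
  | symm h ih => exact (ih r (h.index_eq.1 ▸ hr)).symm
  | trans h1 _ ih1 ih2 => exact (ih1 r hr).trans (ih2 r (h1.index_eq.1 ▸ hr))
  | @comp_congr l m n l' m' n' p q p' q' f g f' g' hf hg ihf ihg =>
    rw [eval_comp, eval_comp, ihg r hr]
    -- The bound `hr` concerns the source of `g`; it applies to `f` only if `l = m`. Otherwise both
    -- sides contain a vanishing factor.
    by_cases hm : l = m
    · rw [ihf r (hm ▸ hr)]
    · have h1 := hf.index_eq
      have h2 := hg.index_eq
      rw [eval_eq_zero F g' (by omega), mul_zero, mul_zero]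
  | tens_congr hf hg ihf ihg =>
    -- The left factor is shifted by the source of the right one, so the shifts on both sides must
    -- be seen to agree.
    have hc := hg.index_eq.1
    rw [eval_tens, eval_tens, ihg r (by omega), ihf _ (by omega), hc]
  | add_congr _ _ ihf ihg => rw [eval_add, eval_add, ihf r hr, ihg r hr]
  | smul_congr c _ ih => rw [eval_smul, eval_smul, ih r hr]
  | add_assoc f g h => exact add_assoc _ _ _
  | add_comm f g => exact add_comm _ _
  | zero_add f => exact zero_add _
  | smul_add c f g => exact smul_add _ _ _
  | add_smul c d f => exact add_smul _ _ _
  | mul_smul c d f => exact mul_smul _ _ _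
  | one_smul f => exact one_smul _ _
  | zero_smul f => exact zero_smul _ _
  | add_comp f f' g => exact add_mul _ _ _
  | comp_add f g g' => exact mul_add _ _ _
  | smul_comp c f g => exact smul_mul_assoc _ _ _
  | comp_smul c f g => exact mul_smul_comm _ _ _
  | add_tens f f' g => exact add_mul _ _ _
  | tens_add f g g' => exact mul_add _ _ _
  | smul_tens c f g => exact smul_mul_assoc _ _ _
  | tens_smul c f g => exact mul_smul_comm _ _ _
  | id_comp f => exact one_mul _
  | comp_id f => exact mul_one _
  | comp_assoc f g h => exact mul_assoc _ _ _
  | tens_id m n => exact one_mul _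
  | id_tens f => exact one_mul _
  | tens_id_zero f => exact mul_one _
  | @tens_assoc a b c d a' b' p q s f g h =>
    simp only [eval_tens, mul_assoc, add_assoc, add_comm c a']
  | @interchange a b c a' b' c' p q p' q' f' g f g' =>
    simp only [eval_comp, eval_tens, eval_smul]
    -- On the left `f'` is shifted by `b'`, on the right by `a'`. If these agree, it remains to let
    -- `g` pass `f`, which act on disjoint strands; if not, the value of `g'` is zero.
    by_cases hb : a' = b'
    · subst hb
      have h := superCommute_eval F f g r (r + a') le_rfl
        (show r + a' + a ≤ N by omega)
      rw [mul_assoc, ← mul_assoc (eval F N g r), h.symm, mul_comm q p]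
      simp only [smul_mul_assoc, mul_smul_comm, mul_assoc]
    · rw [eval_eq_zero F g' hb]
      simp

end PresAlg

end NilHecke

/-! ### Calculus in a strict monoidal supercategory: interchange and adding identity strands. -/

namespace Diagram

variable {k : Type u} {S : Signature.{v}} [CommRing k] {R : Relations k S}

section Rel

variable {l m n m' n' : ℕ} {p q : ZMod 2}

lemma Rel.zero_comp (g : Diagram k S l m q) :
    Rel R (comp (zero m n p) g) (zero l n (p + q)) :=
  (Rel.comp_congr (Rel.zero_smul (zero m n p)).symm (Rel.refl g)).trans
    ((Rel.smul_comp _ _ _).trans (Rel.zero_smul _))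

lemma Rel.comp_zero (f : Diagram k S m n p) :
    Rel R (comp f (zero l m q)) (zero l n (p + q)) :=
  (Rel.comp_congr (Rel.refl f) (Rel.zero_smul (zero l m q)).symm).trans
    ((Rel.comp_smul _ _ _).trans (Rel.zero_smul _))

lemma Rel.zero_tens (g : Diagram k S m' n' q) :
    Rel R (tens (zero m n p) g) (zero (m + m') (n + n') (p + q)) :=
  (Rel.tens_congr (Rel.zero_smul (zero m n p)).symm (Rel.refl g)).trans
    ((Rel.smul_tens _ _ _).trans (Rel.zero_smul _))

lemma Rel.tens_zero (f : Diagram k S m n p) :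
    Rel R (tens f (zero m' n' q)) (zero (m + m') (n + n') (p + q)) :=
  (Rel.tens_congr (Rel.refl f) (Rel.zero_smul (zero m' n' q)).symm).trans
    ((Rel.tens_smul _ _ _).trans (Rel.zero_smul _))

lemma Rel.interchange_of_mul_eq_zero {a b c a' b' c' : ℕ} {p q p' q' : ZMod 2}
    (f' : Diagram k S b c p') (g : Diagram k S b' c' q) (f : Diagram k S a b p)
    (g' : Diagram k S a' b' q') (h : p * q = 0) :
    Rel R (comp (tens f' g) (tens f g')) (tens (comp f' f) (comp g g')) := by
  have h1 := Rel.interchange (R := R) f' g f g'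
  rw [h, sgn_zero] at h1
  exact h1.trans (Rel.one_smul _)

lemma Rel.tens_eq_comp (f : Diagram k S m n p) (g : Diagram k S m' n' q) :
    Rel R (tens f g) (comp (tens f (ident n')) (tens (ident m) g)) :=
  ((Rel.interchange_of_mul_eq_zero f (ident n') (ident m) g (mul_zero 0)).trans
    (Rel.tens_congr (Rel.comp_id f) (Rel.id_comp g))).symm

end Rel

section ToEnd

variable {N : ℕ} {p q : ZMod 2}

lemma toEnd_eq {f : Diagram k S N N p} {g : Diagram k S N N q} (h : Rel R f g) :
    toEnd R f = toEnd R g := by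
  obtain rfl := h.index_eq.2.2
  rw [toEnd, toHom_eq R h]
  rfl

lemma toEnd_comp (f : Diagram k S N N p) (g : Diagram k S N N q) :
    toEnd R (comp f g) = toEnd R f * toEnd R g :=
  (DirectSum.of_mul_of (A := Hom R N N) (toHom R f) (toHom R g)).symm

lemma toEnd_ident : toEnd R (ident N) = 1 := rfl

lemma toEnd_add (f g : Diagram k S N N p) : toEnd R (add f g) = toEnd R f + toEnd R g :=
  map_add (DirectSum.of (Hom R N N) p) (toHom R f) (toHom R g)

lemma toEnd_smul (c : k) (f : Diagram k S N N p) : toEnd R (smul c f) = c • toEnd R f :=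
  map_smul (DirectSum.lof k (ZMod 2) (Hom R N N) p) c (toHom R f)

lemma toEnd_mem_parity (f : Diagram k S N N p) : toEnd R f ∈ EndAlg.parity R N p :=
  ⟨toHom R f, rfl⟩

end ToEnd

section WhiskerEnd

variable {N l r m n m' n' : ℕ} {p q : ZMod 2}

/-- The endomorphism `1^{⊗l} ⊗ f ⊗ 1^{⊗r}` of the object `N = l + m + r = l + n + r`. -/
def whiskerEnd (R : Relations k S) (l r : ℕ) (hm : l + m + r = N) (hn : l + n + r = N)
    (f : Diagram k S m n p) : EndAlg R N :=
  toEnd R (cast (p' := p) hm hn (by simp) (tens (tens (ident l) f) (ident r)))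

lemma whiskerEnd_congr (hm : l + m + r = N) (hn : l + n + r = N) (hm' : l + m' + r = N)
    (hn' : l + n' + r = N) {f : Diagram k S m n p} {g : Diagram k S m' n' q} (h : Rel R f g) :
    whiskerEnd R l r hm hn f = whiskerEnd R l r hm' hn' g :=
  toEnd_eq ((Rel.cast_left R _ _ _ _).trans
    ((Rel.tens_congr (Rel.tens_congr (Rel.refl _) h) (Rel.refl _)).trans
      (Rel.cast_left R _ _ _ _).symm))

lemma whiskerEnd_cast (hm : m = m') (hn : n = n') (hp : p = q) (h : l + m' + r = N)
    (h' : l + n' + r = N) (f : Diagram k S m n p) :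
    whiskerEnd R l r h h' (cast hm hn hp f) =
      whiskerEnd R l r (hm ▸ h) (hn ▸ h') f :=
  whiskerEnd_congr _ _ _ _ (Rel.cast_left R _ _ _ _)

/-- The interchange law is applied twice; both times one of the two exchanged morphisms is an
identity, hence even, so no sign arises. -/
lemma whiskerEnd_comp {m₀ : ℕ} (h₀ : l + m₀ + r = N) (hm : l + m + r = N) (hn : l + n + r = N)
    (f : Diagram k S m n p) (g : Diagram k S m₀ m q) :
    whiskerEnd R l r h₀ hn (comp f g) =
      whiskerEnd R l r hm hn f * whiskerEnd R l r h₀ hm g := by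
  rw [whiskerEnd, whiskerEnd, whiskerEnd, ← toEnd_comp]
  refine toEnd_eq ((Rel.cast_left R _ _ _ _).trans (Rel.symm ?_))
  refine (Rel.comp_congr (Rel.cast_left R _ _ _ _) (Rel.cast_left R _ _ _ _)).trans ?_
  refine (Rel.interchange_of_mul_eq_zero _ _ _ _ (mul_zero _)).trans ?_
  refine Rel.tens_congr ?_ (Rel.id_comp _)
  refine (Rel.interchange_of_mul_eq_zero _ _ _ _ (zero_mul _)).trans ?_
  exact Rel.tens_congr (Rel.id_comp _) (Rel.refl _)

lemma whiskerEnd_ident (h : l + m + r = N) : whiskerEnd R l r h h (ident m) = 1 := by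
  subst h
  rw [← toEnd_ident]
  refine toEnd_eq ((Rel.cast_left R _ _ _ _).trans ?_)
  exact (Rel.tens_congr (Rel.tens_id _ _) (Rel.refl _)).trans (Rel.tens_id _ _)

lemma whiskerEnd_add (hm : l + m + r = N) (hn : l + n + r = N) (f g : Diagram k S m n p) :
    whiskerEnd R l r hm hn (add f g) = whiskerEnd R l r hm hn f + whiskerEnd R l r hm hn g := by
  rw [whiskerEnd, whiskerEnd, whiskerEnd, ← toEnd_add]
  refine toEnd_eq ((Rel.cast_left R _ _ _ _).trans ?_)
  refine ((Rel.tens_congr (Rel.tens_add _ _ _) (Rel.refl _)).trans (Rel.add_tens _ _ _)).trans ?_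
  exact Rel.add_congr (Rel.cast_left R _ _ _ _).symm (Rel.cast_left R _ _ _ _).symm

lemma whiskerEnd_smul (hm : l + m + r = N) (hn : l + n + r = N) (c : k) (f : Diagram k S m n p) :
    whiskerEnd R l r hm hn (smul c f) = c • whiskerEnd R l r hm hn f := by
  rw [whiskerEnd, whiskerEnd, ← toEnd_smul]
  refine toEnd_eq ((Rel.cast_left R _ _ _ _).trans ?_)
  refine ((Rel.tens_congr (Rel.tens_smul _ _ _) (Rel.refl _)).trans (Rel.smul_tens _ _ _)).trans ?_
  exact Rel.smul_congr _ (Rel.cast_left R _ _ _ _).symm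

lemma whiskerEnd_zero (hm : l + m + r = N) (hn : l + n + r = N) :
    whiskerEnd R l r hm hn (zero (k := k) (S := S) m n p) = 0 := by
  rw [whiskerEnd_congr hm hn hm hn (Rel.zero_smul (zero m n p)).symm, whiskerEnd_smul, zero_smul]

lemma whiskerEnd_sum (hm : l + m + r = N) (hn : l + n + r = N) (L : List (Diagram k S m n p)) :
    whiskerEnd R l r hm hn (Diagram.sum L) = (L.map (whiskerEnd R l r hm hn)).sum := by
  induction L with
  | nil => exact whiskerEnd_zero hm hn
  | cons f L ih => rw [List.map_cons, List.sum_cons, ← ih]; exact whiskerEnd_add hm hn f _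

lemma whiskerEnd_tens_ident {r' : ℕ} (h : l + (m + m') + r = N) (h' : l + m + r' = N)
    (f : Diagram k S m m p) :
    whiskerEnd R l r h h (tens f (ident m')) = whiskerEnd R l r' h' h' f := by
  obtain rfl : r' = m' + r := by omega
  refine toEnd_eq ((Rel.cast_left R _ _ _ _).trans (Rel.trans ?_ (Rel.cast_left R _ _ _ _).symm))
  refine (Rel.tens_congr (Rel.tens_assoc _ _ _).symm (Rel.refl _)).trans ?_
  exact (Rel.tens_assoc _ _ _).trans (Rel.tens_congr (Rel.refl _) (Rel.tens_id _ _))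

lemma whiskerEnd_ident_tens {l' : ℕ} (h : l + (m + m') + r = N) (h' : l' + m' + r = N)
    (g : Diagram k S m' m' p) :
    whiskerEnd R l r h h (tens (ident m) g) = whiskerEnd R l' r h' h' g := by
  obtain rfl : l' = l + m := by omega
  refine toEnd_eq ((Rel.cast_left R _ _ _ _).trans (Rel.trans ?_ (Rel.cast_left R _ _ _ _).symm))
  refine Rel.tens_congr ?_ (Rel.refl _)
  exact (Rel.tens_assoc _ _ _).symm.trans (Rel.tens_congr (Rel.tens_id _ _) (Rel.refl _))

lemma whiskerEnd_tens {l' r' : ℕ} (h : l + (m + m') + r = N) (hf : l + m + r' = N)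
    (hg : l' + m' + r = N) (f : Diagram k S m m p) (g : Diagram k S m' m' q) :
    whiskerEnd R l r h h (tens f g) = whiskerEnd R l r' hf hf f * whiskerEnd R l' r hg hg g := by
  rw [whiskerEnd_congr h h h h (Rel.tens_eq_comp f g), whiskerEnd_comp h h h,
    whiskerEnd_tens_ident h hf, whiskerEnd_ident_tens h hg]

/-- By the interchange law both orders of composition equal `f ⊗ g` up to sign, and only the one in
which `g` has to pass `f` carries the sign. -/
lemma superCommute_whiskerEnd_adjacent {l' r' : ℕ} (h : l + (m + m') + r = N)
    (hf : l + m + r' = N) (hg : l' + m' + r = N) (f : Diagram k S m m p)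
    (g : Diagram k S m' m' q) :
    SuperCommute k p q (whiskerEnd R l r' hf hf f) (whiskerEnd R l' r hg hg g) := by
  have hrel : Rel R (comp (tens (ident m) g) (tens f (ident m'))) (smul (sgn k (p * q)) (tens f g)) :=
    (Rel.interchange _ _ _ _).trans
      (Rel.smul_congr _ (Rel.tens_congr (Rel.id_comp f) (Rel.comp_id g)))
  rw [SuperCommute, ← whiskerEnd_tens_ident h hf, ← whiskerEnd_ident_tens h hg,
    ← whiskerEnd_comp h h h, ← whiskerEnd_comp h h h, whiskerEnd_congr h h h h hrel,
    whiskerEnd_smul, smul_smul, sgn_mul_self, one_smul,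
    whiskerEnd_congr h h h h (Rel.tens_eq_comp f g).symm]

/-- Endomorphisms of disjoint sets of strands supercommute. -/
lemma superCommute_whiskerEnd_of_le {l' r' : ℕ} (hf : l + m + r = N) (hg : l' + m' + r' = N)
    (h : r' + m' ≤ r) (f : Diagram k S m m p) (g : Diagram k S m' m' q) :
    SuperCommute k p q (whiskerEnd R l r hf hf f) (whiskerEnd R l' r' hg hg g) := by
  -- The `r - m' - r'` strands between `f` and `g` are absorbed into `g` as identity strands, which
  -- makes the two adjacent. By `h` the subtraction is not truncated.
  have h0 : l + (m + (r - m' - r' + m')) + r' = N := by omega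
  have h1 := superCommute_whiskerEnd_adjacent (R := R) h0 hf (by omega : l + m + _ + r' = N) f
    (tens (ident (r - m' - r')) g)
  rwa [whiskerEnd_ident_tens _ hg, zero_add] at h1

lemma superCommute_whiskerEnd {l' r' : ℕ} (hf : l + m + r = N) (hg : l' + m' + r' = N)
    (h : r' + m' ≤ r ∨ r + m ≤ r') (f : Diagram k S m m p) (g : Diagram k S m' m' q) :
    SuperCommute k p q (whiskerEnd R l r hf hf f) (whiskerEnd R l' r' hg hg g) := by
  rcases h with h | h
  · exact superCommute_whiskerEnd_of_le hf hg h f g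
  · exact (superCommute_whiskerEnd_of_le hg hf h g f).symm

end WhiskerEnd

end Diagram

/-! ### The homomorphism from the presented algebra to the endomorphism algebra. -/

section NilHecke

variable {k : Type u} [CommRing k] {A : Type v} [Ring A] [Algebra k A]
variable {𝒜 : ZMod 2 → Submodule k A} [GradedAlgebra 𝒜] {ι : Type w} [Fintype ι] [DecidableEq ι]

lemma SuperCommute.revProd_right {E : Type*} [Ring E] [Algebra k E] {p : ZMod 2} {y : E}
    (q : ℕ → ZMod 2) (c : ℕ → E) (n : ℕ) (h : ∀ i < n, SuperCommute k p (q i) y (c i)) :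
    SuperCommute k p (∑ i ∈ Finset.range n, q i) y (revProd c n) := by
  induction n with
  | zero => exact SuperCommute.one_right y
  | succ n ih =>
    rw [Finset.sum_range_succ, add_comm, revProd]
    exact (h n (by omega)).mul_right (ih fun i hi => h i (by omega))

lemma revProd_mem_graded {E : Type*} [Ring E] [Algebra k E] (ℬ : ZMod 2 → Submodule k E)
    [SetLike.GradedMonoid ℬ] (q : ℕ → ZMod 2) (c : ℕ → E) (n : ℕ) (h : ∀ i < n, c i ∈ ℬ (q i)) :
    revProd c n ∈ ℬ (∑ i ∈ Finset.range n, q i) := by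
  induction n with
  | zero => exact SetLike.GradedOne.one_mem
  | succ n ih =>
    rw [Finset.sum_range_succ, add_comm, revProd]
    exact SetLike.mul_mem_graded (h n (by omega)) (ih fun i hi => h i (by omega))

lemma sum_eq_sum_range_dite {M : Type*} [AddCommMonoid M] {n : ℕ} (q : Fin n → M) :
    ∑ i, q i = ∑ i ∈ Finset.range n, if h : i < n then q ⟨i, h⟩ else 0 := by
  rw [← Fin.sum_univ_eq_sum_range (fun i => if h : i < n then q ⟨i, h⟩ else 0)]
  simp

namespace NilHeckeAlg

open Diagram

variable (F : SymmetricFrobenius 𝒜 ι) {n : ℕ}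

/-- Replaces the truncated difference by any `l` with the right sum, so that generators can be
rewritten inside larger windows of strands. The next two lemmas serve the same purpose. -/
lemma crossing_eq (i : Fin (n - 1)) (l : ℕ) (h : l + 2 + i = n) :
    crossing F i = whiskerEnd (NHRel F) l i h h (cross F) := by
  obtain rfl : l = n - 2 - i := by omega
  rfl

lemma dotOn_eq (j : Fin n) (l : ℕ) (h : l + 1 + j = n) :
    dotOn F j = whiskerEnd (NHRel F) l j h h (dot F) := by
  obtain rfl : l = n - 1 - j := by omega
  rfl

lemma tokenOn_eq (j : Fin n) {p : ZMod 2} (a : 𝒜 p) (l : ℕ) (h : l + 1 + j = n) :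
    tokenOn F j a = whiskerEnd (NHRel F) l j h h (token F a) := by
  obtain rfl : l = n - 1 - j := by omega
  rfl

lemma whiskerEnd_eq_of_relation {l r a b : ℕ} {p q : ZMod 2} (ha : l + a + r = n)
    (hb : l + b + r = n) (hpq : p = q) {f : Diagram k (NHSig F) a b p}
    {g : Diagram k (NHSig F) a b q} (h : NHRel F f g) :
    whiskerEnd (NHRel F) l r ha hb f = whiskerEnd (NHRel F) l r ha hb g :=
  whiskerEnd_congr _ _ _ _ (Rel.of _ _ hpq h)

lemma crossing_mul_self (i : Fin (n - 1)) : crossing F i * crossing F i = 0 := by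
  have h : n - 2 - i + 2 + i = n := by omega
  rw [crossing_eq F i _ h, ← whiskerEnd_comp,
    whiskerEnd_eq_of_relation F h h (add_zero 0) NHRel.cross_cross, whiskerEnd_zero]

lemma crossing_comm (i j : Fin (n - 1)) (h : (i : ℕ) + 1 < j ∨ (j : ℕ) + 1 < i) :
    crossing F i * crossing F j = crossing F j * crossing F i := by
  have h1 : SuperCommute k 0 0 (crossing F i) (crossing F j) :=
    superCommute_whiskerEnd _ _ (by omega) _ _
  rwa [SuperCommute, zero_mul, sgn_zero, one_smul] at h1

lemma crossing_braid (i j : Fin (n - 1)) (hij : (j : ℕ) = i + 1) :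
    crossing F i * crossing F j * crossing F i = crossing F j * crossing F i * crossing F j := by
  obtain ⟨l, h⟩ : ∃ l, l + 3 + i = n := ⟨n - 3 - i, by omega⟩
  obtain ⟨j, hj⟩ := j
  obtain rfl : j = i + 1 := hij
  -- Both crossings are viewed in the same window of three strands. Strands are numbered from the
  -- right, so the crossing with the smaller index is `crossRight`.
  have hi : crossing F i = whiskerEnd (NHRel F) l i h h (crossRight F) := by
    rw [crossing_eq F i (l + 1) (by omega), crossRight, whiskerEnd_cast]
    exact (whiskerEnd_ident_tens (m := 1) (m' := 2) h (by omega) _).symm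
  have hj : crossing F ⟨i + 1, hj⟩ = whiskerEnd (NHRel F) l i h h (crossLeft F) := by
    rw [crossLeft, whiskerEnd_cast, whiskerEnd_tens_ident (m := 2) (m' := 1) h
      (show l + 2 + (i + 1) = n by omega)]
    obtain rfl : l = n - 2 - (i + 1) := by omega
    rfl
  rw [hi, hj, mul_assoc, mul_assoc, ← whiskerEnd_comp, ← whiskerEnd_comp, ← whiskerEnd_comp,
    ← whiskerEnd_comp]
  exact (whiskerEnd_eq_of_relation F h h (by simp) NHRel.braid).symm

lemma superCommute_crossing_dotOn (i : Fin (n - 1)) (j : Fin n) (h1 : j ≠ lo i) (h2 : j ≠ hi i) :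
    SuperCommute k 0 F.σ (crossing F i) (dotOn F j) := by
  refine superCommute_whiskerEnd _ _ ?_ _ _
  simp only [lo, hi, ne_eq, Fin.ext_iff] at h1 h2
  omega

lemma superCommute_crossing_tokenOn (i : Fin (n - 1)) (j : Fin n) (h1 : j ≠ lo i) (h2 : j ≠ hi i)
    {p : ZMod 2} (a : 𝒜 p) : SuperCommute k 0 p (crossing F i) (tokenOn F j a) := by
  refine superCommute_whiskerEnd _ _ ?_ _ _
  simp only [lo, hi, ne_eq, Fin.ext_iff] at h1 h2
  omega

lemma superCommute_dotOn_dotOn (i j : Fin n) (h : i ≠ j) :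
    SuperCommute k F.σ F.σ (dotOn F i) (dotOn F j) := by
  refine superCommute_whiskerEnd _ _ ?_ _ _
  simp only [ne_eq, Fin.ext_iff] at h
  omega

lemma superCommute_tokenOn_tokenOn (i j : Fin n) (h : i ≠ j) {p q : ZMod 2} (a : 𝒜 p) (b : 𝒜 q) :
    SuperCommute k p q (tokenOn F i a) (tokenOn F j b) := by
  refine superCommute_whiskerEnd _ _ ?_ _ _
  simp only [ne_eq, Fin.ext_iff] at h
  omega

/-- On one strand this is the defining relation between tokens and dots; on different strands it is
the interchange law. -/
lemma superCommute_tokenOn_dotOn (i j : Fin n) {p : ZMod 2} (a : 𝒜 p) :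
    SuperCommute k p F.σ (tokenOn F i a) (dotOn F j) := by
  by_cases hij : i = j
  · subst hij
    have h : n - 1 - i + 1 + i = n := by omega
    rw [SuperCommute, tokenOn_eq F i a _ h, dotOn_eq F i _ h, ← whiskerEnd_comp,
      whiskerEnd_eq_of_relation F h h (add_comm _ _) (NHRel.token_dot a), whiskerEnd_smul,
      whiskerEnd_comp h h h, mul_comm p]
  · refine superCommute_whiskerEnd _ _ ?_ _ _
    simp only [Fin.ext_iff] at hij
    omega

/-- Tokens on the strand `j`, as a linear map in the label. -/
def tokenₗ (j : Fin n) (p : ZMod 2) : 𝒜 p →ₗ[k] NilHeckeAlg F n :=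
  have key : ∀ (c d : k) (a b : 𝒜 p),
      tokenOn F j (c • a + d • b) = c • tokenOn F j a + d • tokenOn F j b := by
    intro c d a b
    have h : n - 1 - j + 1 + j = n := by omega
    simp only [tokenOn_eq F j _ _ h]
    rw [whiskerEnd_eq_of_relation F h h rfl (NHRel.token_linear c d a b), whiskerEnd_add,
      whiskerEnd_smul, whiskerEnd_smul]
  { toFun := tokenOn F j
    map_add' := fun a b => by simpa using key 1 1 a b
    map_smul' := fun c a => by simpa using key c 0 a 0 }

lemma tokenₗ_apply (j : Fin n) {p : ZMod 2} (a : 𝒜 p) : tokenₗ F j p a = tokenOn F j a := rfl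

/-- Tokens on the strand `j`, as an algebra homomorphism in the label. -/
def tokenHom (j : Fin n) : A →ₐ[k] NilHeckeAlg F n :=
  -- Tokens exist only for homogeneous labels, so the map is defined on `⨁ p, 𝒜 p` and transported
  -- to `A` along the decomposition.
  (DirectSum.toAlgebra k (fun p => 𝒜 p) (tokenₗ F j)
    (by
      have h : n - 1 - j + 1 + j = n := by omega
      rw [tokenₗ_apply, tokenOn_eq F j _ _ h]
      exact (whiskerEnd_eq_of_relation F h h rfl NHRel.token_one).trans (whiskerEnd_ident h))
    (by
      intro p q a b
      have h : n - 1 - j + 1 + j = n := by omega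
      simp only [tokenₗ_apply, tokenOn_eq F j _ _ h]
      rw [← whiskerEnd_comp]
      exact (whiskerEnd_eq_of_relation F h h rfl (NHRel.token_mul a b)).symm)).comp
  (DirectSum.decomposeAlgEquiv 𝒜).toAlgHom

lemma tokenHom_apply (j : Fin n) {p : ZMod 2} (a : 𝒜 p) :
    tokenHom F j (a : A) = tokenOn F j a := by
  have h : (DirectSum.decomposeAlgEquiv 𝒜).toAlgHom (a : A) = DirectSum.of (fun p => 𝒜 p) p a :=
    DirectSum.decompose_coe 𝒜 a
  rw [tokenHom, AlgHom.comp_apply, h]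
  exact (DirectSum.toModule_lof k p a : DirectSum.toModule k (ZMod 2) _ (tokenₗ F j) _ = _)

/-- The tokens on the various strands, as an algebra homomorphism on `A^{⊗n}`. -/
def tensHom (n : ℕ) : SuperTensorPower 𝒜 n →ₐ[k] NilHeckeAlg F n :=
  SuperTensorPower.lift 𝒜 (tokenHom F) fun i j hij p q a ha b hb => by
    rw [tokenHom_apply F i ⟨a, ha⟩, tokenHom_apply F j ⟨b, hb⟩]
    exact superCommute_tokenOn_tokenOn F i j hij.ne ⟨a, ha⟩ ⟨b, hb⟩

lemma tensHom_single (j : Fin n) {p : ZMod 2} (a : 𝒜 p) :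
    tensHom F n (SuperTensorPower.single 𝒜 j (a : A)) = tokenOn F j a := by
  rw [tensHom, SuperTensorPower.lift_single, tokenHom_apply]

lemma tensHom_tprod {a : Fin n → A} {p : Fin n → ZMod 2} (ha : ∀ i, a i ∈ 𝒜 (p i)) :
    tensHom F n (SuperTensorPower.tprod 𝒜 a) =
      revProd (fun i => if h : i < n then tokenOn F ⟨i, h⟩ ⟨a ⟨i, h⟩, ha _⟩ else 1) n := by
  rw [tensHom, SuperTensorPower.lift_tprod]
  refine revProd_congr n fun i hi => ?_
  rw [dif_pos hi, dif_pos hi, ← tokenHom_apply]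

/-- A homogeneous pure tensor maps to an ordered product of tokens. The dot supercommutes with each
of them, and the parities add up. -/
lemma superCommute_dotOn_tensHom (j : Fin n) {p : ZMod 2} {a : SuperTensorPower 𝒜 n}
    (ha : a ∈ SuperTensorPower.parity 𝒜 n p) :
    SuperCommute k F.σ p (dotOn F j) (tensHom F n a) := by
  induction ha using Submodule.span_induction with
  | mem x hx =>
    obtain ⟨q, a, ha, rfl, rfl⟩ := hx
    rw [tensHom_tprod F ha]
    rw [sum_eq_sum_range_dite]
    refine SuperCommute.revProd_right _ _ n fun i hi => ?_
    rw [dif_pos hi, dif_pos hi]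
    exact (superCommute_tokenOn_dotOn F _ _ _).symm
  | zero => rw [map_zero]; exact SuperCommute.zero_right _
  | add x y _ _ hx hy => rw [map_add]; exact hx.add_right hy
  | smul c x _ hx => rw [map_smul]; exact hx.smul_right c

lemma tensHom_mem_parity {p : ZMod 2} {a : SuperTensorPower 𝒜 n}
    (ha : a ∈ SuperTensorPower.parity 𝒜 n p) :
    tensHom F n a ∈ EndAlg.parity (NHRel F) n p := by
  induction ha using Submodule.span_induction with
  | mem x hx =>
    obtain ⟨q, a, ha, rfl, rfl⟩ := hx
    rw [tensHom_tprod F ha]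
    rw [sum_eq_sum_range_dite]
    refine revProd_mem_graded _ _ _ n fun i hi => ?_
    rw [dif_pos hi, dif_pos hi]
    exact toEnd_mem_parity _
  | zero => rw [map_zero]; exact zero_mem _
  | add x y _ _ hx hy => rw [map_add]; exact add_mem hx hy
  | smul c x _ hx => rw [map_smul]; exact Submodule.smul_mem _ c hx

lemma whiskerEnd_teleporter {l : ℕ} (i : Fin (n - 1)) (h : l + 2 + i = n) :
    whiskerEnd (NHRel F) l i h h (teleporter F) = tensHom F n (F.tau i) := by
  rw [teleporter, whiskerEnd_sum, List.map_map, Finset.sum_map_toList, F.tau_eq, map_sum]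
  refine Finset.sum_congr rfl fun b _ => ?_
  rw [map_smul, map_mul, Function.comp_apply, whiskerEnd_smul, whiskerEnd_cast,
    whiskerEnd_tens (m := 1) (m' := 1) (l' := l + 1) (r' := i + 1) h (by omega) (by omega),
    tensHom_single F (hi i) ⟨_, F.basis_mem b⟩, tensHom_single F (lo i) ⟨_, F.dual_mem b⟩,
    tokenOn_eq F (lo i) _ (l + 1) (by simp only [lo]; omega),
    tokenOn_eq F (hi i) _ l (by simp only [hi]; omega)]
  rfl

lemma whiskerEnd_hi {l : ℕ} (i : Fin (n - 1)) (h : l + 2 + i = n) (h' : l + 1 + hi i = n)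
    {p : ZMod 2} (f : Diagram k (NHSig F) 1 1 p) :
    whiskerEnd (NHRel F) l (hi i) h' h' f =
      whiskerEnd (NHRel F) l i h h (tens f (ident 1)) :=
  (whiskerEnd_tens_ident (m := 1) (m' := 1) h h' f).symm

lemma whiskerEnd_lo {l : ℕ} (i : Fin (n - 1)) (h : l + 2 + i = n) (h' : l + 1 + 1 + lo i = n)
    {p : ZMod 2} (f : Diagram k (NHSig F) 1 1 p) :
    whiskerEnd (NHRel F) (l + 1) (lo i) h' h' f =
      whiskerEnd (NHRel F) l i h h (tens (ident 1) f) :=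
  (whiskerEnd_ident_tens (m := 1) (m' := 1) h h' f).symm

section Crossing

variable (i : Fin (n - 1)) {l : ℕ} (h : l + 2 + i = n)

include h

/-- This and the following three lemmas place tokens and dots on the strands `hi i` and `lo i` in
the two-strand window of the crossing, where the defining relations live. -/
lemma tokenOn_hi_eq {p : ZMod 2} (a : 𝒜 p) : tokenOn F (hi i) a =
    whiskerEnd (NHRel F) l i h h (tens (token F a) (ident 1)) := by
  rw [tokenOn_eq F (hi i) a l (by simp only [hi]; omega), whiskerEnd_hi]

lemma tokenOn_lo_eq {p : ZMod 2} (a : 𝒜 p) : tokenOn F (lo i) a =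
    whiskerEnd (NHRel F) l i h h (tens (ident 1) (token F a)) := by
  rw [tokenOn_eq F (lo i) a (l + 1) (by simp only [lo]; omega), whiskerEnd_lo]

lemma dotOn_hi_eq : dotOn F (hi i) =
    whiskerEnd (NHRel F) l i h h (tens (dot F) (ident 1)) := by
  rw [dotOn_eq F (hi i) l (by simp only [hi]; omega), whiskerEnd_hi]

lemma dotOn_lo_eq : dotOn F (lo i) =
    whiskerEnd (NHRel F) l i h h (tens (ident 1) (dot F)) := by
  rw [dotOn_eq F (lo i) (l + 1) (by simp only [lo]; omega), whiskerEnd_lo]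

end Crossing

lemma exists_left_strands (i : Fin (n - 1)) : ∃ l, l + 2 + i = n :=
  ⟨n - 2 - i, by omega⟩

lemma crossing_mul_tokenOn_hi (i : Fin (n - 1)) {p : ZMod 2} (a : 𝒜 p) :
    crossing F i * tokenOn F (hi i) a = tokenOn F (lo i) a * crossing F i := by
  obtain ⟨l, h⟩ := exists_left_strands i
  rw [crossing_eq F i l h, tokenOn_hi_eq F i h, tokenOn_lo_eq F i h, ← whiskerEnd_comp,
    ← whiskerEnd_comp]
  exact whiskerEnd_eq_of_relation F h h (by ring) (NHRel.cross_token_left a)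

lemma crossing_mul_tokenOn_lo (i : Fin (n - 1)) {p : ZMod 2} (a : 𝒜 p) :
    crossing F i * tokenOn F (lo i) a = tokenOn F (hi i) a * crossing F i := by
  obtain ⟨l, h⟩ := exists_left_strands i
  rw [crossing_eq F i l h, tokenOn_hi_eq F i h, tokenOn_lo_eq F i h, ← whiskerEnd_comp,
    ← whiskerEnd_comp]
  exact whiskerEnd_eq_of_relation F h h (by ring) (NHRel.cross_token_right a)

lemma crossing_mul_dotOn_hi (i : Fin (n - 1)) :
    crossing F i * dotOn F (hi i) = dotOn F (lo i) * crossing F i + tensHom F n (F.tau i) := by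
  obtain ⟨l, h⟩ := exists_left_strands i
  rw [crossing_eq F i l h, dotOn_hi_eq F i h, dotOn_lo_eq F i h, ← whiskerEnd_comp,
    ← whiskerEnd_comp, ← whiskerEnd_teleporter F i h]
  refine (whiskerEnd_eq_of_relation F h h (by simp) NHRel.cross_dot_left).trans ?_
  rw [whiskerEnd_add, whiskerEnd_cast]

lemma dotOn_hi_mul_crossing (i : Fin (n - 1)) :
    dotOn F (hi i) * crossing F i =
      crossing F i * dotOn F (lo i) + sgn k F.σ • tensHom F n (F.tau i) := by
  obtain ⟨l, h⟩ := exists_left_strands i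
  rw [crossing_eq F i l h, dotOn_hi_eq F i h, dotOn_lo_eq F i h, ← whiskerEnd_comp,
    ← whiskerEnd_comp, ← whiskerEnd_teleporter F i h]
  refine (whiskerEnd_eq_of_relation F h h (by simp) NHRel.dot_cross_left).trans ?_
  rw [whiskerEnd_add, whiskerEnd_smul, whiskerEnd_cast]

/-- Both sides are linear in `a`, so `a` may be a homogeneous pure tensor, that is, an ordered
product of tokens. The crossing slides past them one by one, and the sign of `superSwap` comes from
restoring the order of the two exchanged tokens. -/
lemma crossing_mul_tensHom (i : Fin (n - 1)) (a : SuperTensorPower 𝒜 n) :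
    crossing F i * tensHom F n a = tensHom F n (superSwap 𝒜 i a) * crossing F i := by
  induction a using SuperTensorPower.induction_on_homogeneous 𝒜 with
  | zero =>
    have h : superSwap 𝒜 i 0 = 0 := map_zero (superSwapAux 𝒜 i)
    rw [h, map_zero, mul_zero, zero_mul]
  | add x y hx hy =>
    have h : superSwap 𝒜 i (x + y) = superSwap 𝒜 i x + superSwap 𝒜 i y :=
      map_add (superSwapAux 𝒜 i) x y
    rw [h, map_add, map_add, mul_add, add_mul, hx, hy]
  | smul c x hx =>
    have h : superSwap 𝒜 i (c • x) = c • superSwap 𝒜 i x := map_smul (superSwapAux 𝒜 i) c x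
    rw [h, map_smul, map_smul, mul_smul_comm, smul_mul_assoc, hx]
  | tprod p a ha =>
    rw [SuperTensorPower.superSwap_tprod 𝒜 ha, map_smul, tensHom, SuperTensorPower.lift_tprod,
      SuperTensorPower.lift_tprod, smul_mul_assoc]
    have htok : ∀ (j l : Fin n), tokenHom F j (a l) = tokenOn F j ⟨a l, ha l⟩ := fun j l =>
      tokenHom_apply F j ⟨a l, ha l⟩
    have hlo : (i : ℕ) < n := by omega
    have hhi : (i : ℕ) + 1 < n := by omega
    have elo : (⟨i, hlo⟩ : Fin n) = lo i := rfl
    have ehi : (⟨i + 1, hhi⟩ : Fin n) = hi i := rfl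
    have slo : Equiv.swap (lo i) (hi i) (lo i) = hi i := Equiv.swap_apply_left _ _
    have shi : Equiv.swap (lo i) (hi i) (hi i) = lo i := Equiv.swap_apply_right _ _
    refine mul_revProd_of_swap _ _ _ _ (i : ℕ) n hhi ?_ ?_ ?_ ?_
    · simp only [dif_pos hlo, dif_pos hhi, elo, ehi, shi, htok, crossing_mul_tokenOn_lo]
    · simp only [dif_pos hlo, dif_pos hhi, elo, ehi, slo, htok, crossing_mul_tokenOn_hi]
    · intro j hj h1 h2
      have hjlo : (⟨j, hj⟩ : Fin n) ≠ lo i := by simpa [lo] using h1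
      have hjhi : (⟨j, hj⟩ : Fin n) ≠ hi i := by simpa [hi] using h2
      have h := superCommute_crossing_tokenOn F i ⟨j, hj⟩ hjlo hjhi ⟨a ⟨j, hj⟩, ha _⟩
      rw [SuperCommute, zero_mul, sgn_zero, one_smul] at h
      simp only [dif_pos hj, Equiv.swap_apply_of_ne_of_ne hjlo hjhi, htok]
      exact h
    · simp only [dif_pos hlo, dif_pos hhi, elo, ehi, slo, shi, htok]
      -- After the exchange the strand `lo i` carries `a (hi i)` and vice versa, so the parities
      -- occur in the opposite order.
      rw [mul_comm (p (lo i))]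
      exact superCommute_tokenOn_tokenOn F (lo i) (hi i) (by simp [lo, hi])
        ⟨a (hi i), ha _⟩ ⟨a (lo i), ha _⟩

/-- The homomorphisms from the factors of the free product given by the crossings, dots and
tokens. -/
def ofFactor (n : ℕ) : ∀ {b : Bool}, NHFactor 𝒜 n b →ₐ[k] NilHeckeAlg F n
  | true => (tensHom F n : SuperTensorPower 𝒜 n →ₐ[k] NilHeckeAlg F n)
  | false => (FreeAlgebra.lift k (fun
      | .u i => crossing F i
      | .x j => dotOn F j) : FreeAlgebra k (NHVar.{v} n) →ₐ[k] NilHeckeAlg F n)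

/-- The homomorphism from the free product given by the crossings, dots and tokens. -/
def ofFree (n : ℕ) : NHFree 𝒜 n →ₐ[k] NilHeckeAlg F n :=
  LinearAlgebra.FreeProduct.lift k (NHFactor 𝒜 n) (ofFactor F n)

lemma ofFree_ι (b : Bool) (y : NHFactor 𝒜 n b) :
    ofFree F n (LinearAlgebra.FreeProduct.ι k (NHFactor 𝒜 n) b y) = ofFactor F n y :=
  DFunLike.congr_fun
    (LinearAlgebra.FreeProduct.lift_comp_ι k (NHFactor 𝒜 n) (ofFactor F n) (i := b)) y

lemma ofFree_tens (a : SuperTensorPower 𝒜 n) : ofFree F n (NHFree.tens n a) = tensHom F n a :=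
  ofFree_ι F true a

lemma ofFree_u (i : Fin (n - 1)) : ofFree F n (NHFree.u 𝒜 i) = crossing F i :=
  (ofFree_ι F false _).trans (FreeAlgebra.lift_ι_apply _ _)

lemma ofFree_x (j : Fin n) : ofFree F n (NHFree.x 𝒜 j) = dotOn F j :=
  (ofFree_ι F false _).trans (FreeAlgebra.lift_ι_apply _ _)

lemma ofFree_eq_of_rel {y z : NHFree 𝒜 n} (h : PresRel F n y z) :
    ofFree F n y = ofFree F n z := by
  cases h <;> simp only [map_mul, map_add, map_smul, map_zero, ofFree_tens, ofFree_u, ofFree_x]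
  case u_sq i => exact crossing_mul_self F i
  case u_comm i j h => exact crossing_comm F i j h
  case u_braid i j h => exact crossing_braid F i j h
  case u_tens i a => exact crossing_mul_tensHom F i a
  case x_comm i j h =>
    have h := superCommute_dotOn_dotOn F i j h
    rwa [SuperCommute, sgn_sq_arg] at h
  case tens_x p a j h =>
    have h := (superCommute_dotOn_tensHom F j h).symm
    rwa [SuperCommute, mul_comm p] at h
  case x_u_comm i j h1 h2 =>
    have h := superCommute_crossing_dotOn F i j h1 h2
    rw [SuperCommute, zero_mul, sgn_zero, one_smul] at h
    exact h.symm
  case u_x i => exact crossing_mul_dotOn_hi F i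
  case x_u i => exact dotOn_hi_mul_crossing F i

/-- The homomorphism from the presented algebra to the Frobenius nilHecke algebra. -/
def ofPres (n : ℕ) : PresAlg F n →ₐ[k] NilHeckeAlg F n :=
  RingQuot.liftAlgHom k ⟨ofFree F n, fun _ _ => ofFree_eq_of_rel F⟩

lemma ofPres_tens (a : SuperTensorPower 𝒜 n) : ofPres F n (PresAlg.tens F a) = tensHom F n a := by
  rw [PresAlg.tens, ofPres, RingQuot.liftAlgHom_mkAlgHom_apply, ofFree_tens]

lemma ofPres_u (i : Fin (n - 1)) : ofPres F n (PresAlg.u F i) = crossing F i := by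
  rw [PresAlg.u, ofPres, RingQuot.liftAlgHom_mkAlgHom_apply, ofFree_u]

lemma ofPres_x (j : Fin n) : ofPres F n (PresAlg.x F j) = dotOn F j := by
  rw [PresAlg.x, ofPres, RingQuot.liftAlgHom_mkAlgHom_apply, ofFree_x]

end NilHeckeAlg

end NilHecke

/-! ### The inverse homomorphism and the comparison of parities. -/

section NilHecke

variable {k : Type u} [CommRing k] {A : Type v} [Ring A] [Algebra k A]
variable {𝒜 : ZMod 2 → Submodule k A} [GradedAlgebra 𝒜] {ι : Type w} [Fintype ι] [DecidableEq ι]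

namespace PresAlg

variable (F : SymmetricFrobenius 𝒜 ι) {n : ℕ}

/-- Homomorphisms out of the presented algebra that agree on the generators are equal. -/
lemma algHom_ext {E : Type*} [Ring E] [Algebra k E] {f g : PresAlg F n →ₐ[k] E}
    (htens : ∀ (j : Fin n) (p : ZMod 2) (a : 𝒜 p),
      f (tens F (SuperTensorPower.single 𝒜 j (a : A))) =
        g (tens F (SuperTensorPower.single 𝒜 j (a : A))))
    (hu : ∀ i, f (u F i) = g (u F i)) (hx : ∀ j, f (x F j) = g (x F j)) : f = g := by
  refine RingQuot.ringQuot_ext' _ _ _ ?_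
  refine (LinearAlgebra.FreeProduct.lift k (NHFactor 𝒜 n)).symm.injective ?_
  funext b
  cases b with
  | false =>
    refine FreeAlgebra.hom_ext (R := k) (X := NHVar.{v} n) ?_
    funext y
    cases y with
    | u i => exact hu i
    | x j => exact hx j
  | true =>
    exact SuperTensorPower.algHom_ext 𝒜 (f := f.comp (tensHom F n)) (g := g.comp (tensHom F n))
      fun j p a ha => htens j p ⟨a, ha⟩

end PresAlg

namespace NilHeckeAlg

open Diagram PresAlg

variable (F : SymmetricFrobenius 𝒜 ι) {N : ℕ}

/-- The evaluation of morphisms in the presented algebra. -/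
def evalHom (N : ℕ) (p : ZMod 2) : Hom (NHRel F) N N p →ₗ[k] PresAlg F N where
  -- An endomorphism of the object `N` occupies all strands, so its rightmost strand is the strand
  -- `0` and the bound `0 + N ≤ N` holds.
  toFun := Quotient.lift (fun f => eval F N f 0) fun _ _ h => eval_eq_of_rel F h 0 (by omega)
  map_add' f g := by
    obtain ⟨f, rfl⟩ := toHom_surjective _ f
    obtain ⟨g, rfl⟩ := toHom_surjective _ g
    rfl
  map_smul' c f := by
    obtain ⟨f, rfl⟩ := toHom_surjective _ f
    rfl

/-- The homomorphism from the Frobenius nilHecke algebra to the presented algebra. -/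
def toPres (N : ℕ) : NilHeckeAlg F N →ₐ[k] PresAlg F N :=
  DirectSum.toAlgebra k (Hom (NHRel F) N N) (evalHom F N) rfl fun {p q} f g => by
    obtain ⟨f, rfl⟩ := toHom_surjective _ f
    obtain ⟨g, rfl⟩ := toHom_surjective _ g
    rfl

lemma toPres_toEnd {p : ZMod 2} (f : Diagram k (NHSig F) N N p) :
    toPres F N (toEnd (NHRel F) f) = eval F N f 0 :=
  (DirectSum.toModule_lof k p _ : DirectSum.toModule k (ZMod 2) _ (evalHom F N) _ = _)

lemma toPres_whiskerEnd {l r m : ℕ} (h : l + m + r = N) {p : ZMod 2}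
    (f : Diagram k (NHSig F) m m p) :
    toPres F N (whiskerEnd (NHRel F) l r h h f) = eval F N f r := by
  rw [whiskerEnd, toPres_toEnd, eval_cast, eval_tens, eval_tens, eval_ident, eval_ident, one_mul,
    mul_one, zero_add]

lemma toPres_comp_ofPres : (toPres F N).comp (ofPres F N) = AlgHom.id k (PresAlg F N) := by
  refine PresAlg.algHom_ext F (E := PresAlg F N) (fun j p a => ?_) (fun i => ?_) (fun j => ?_)
  · rw [AlgHom.comp_apply, ofPres_tens, tensHom_single]
    exact (toPres_whiskerEnd F _ _).trans (eval_token F j.2 a)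
  · rw [AlgHom.comp_apply, ofPres_u]
    exact (toPres_whiskerEnd F _ _).trans (eval_cross F i.2)
  · rw [AlgHom.comp_apply, ofPres_x]
    exact (toPres_whiskerEnd F _ _).trans (eval_dot F j.2)

omit [GradedAlgebra 𝒜] in
variable {F} in
-- The counterpart of `eval_eq_zero` inside the category: there are no nonzero morphisms between
-- different objects.
lemma rel_zero_of_ne {R : Relations k (NHSig F)} {m n : ℕ} {p : ZMod 2}
    (f : Diagram k (NHSig F) m n p) (h : m ≠ n) : Rel R f (zero m n p) := by
  induction f with
  | gen g => cases g <;> exact absurd rfl h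
  | ident n => exact absurd rfl h
  | @comp l m n p q f g ihf ihg =>
    by_cases hm : l = m
    · exact (Rel.comp_congr (ihf (by omega)) (Rel.refl g)).trans (Rel.zero_comp g)
    · exact (Rel.comp_congr (Rel.refl f) (ihg hm)).trans (Rel.comp_zero f)
  | @tens m n m' n' p q f g ihf ihg =>
    by_cases hm : m = n
    · exact (Rel.tens_congr (Rel.refl f) (ihg (by omega))).trans (Rel.tens_zero f)
    · exact (Rel.tens_congr (ihf hm) (Rel.refl g)).trans (Rel.zero_tens g)
  | zero m n p => exact Rel.refl _
  | add f g ihf ihg => exact (Rel.add_congr (ihf h) (ihg h)).trans (Rel.zero_add _)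
  | smul c f ih =>
    refine (Rel.smul_congr c ((ih h).trans (Rel.zero_smul (zero _ _ _)).symm)).trans ?_
    refine (Rel.mul_smul c 0 _).symm.trans ?_
    rw [mul_zero]
    exact Rel.zero_smul _

lemma whiskerEnd_eq_zero {l r m n : ℕ} {p : ZMod 2} (hm : l + m + r = N) (hn : l + n + r = N)
    {f : Diagram k (NHSig F) m n p} (h : Rel (NHRel F) f (zero m n p)) :
    whiskerEnd (NHRel F) l r hm hn f = 0 := by
  rw [whiskerEnd_congr hm hn hm hn h, whiskerEnd_zero]

/-- Structural induction: both sides turn composition and tensor product into multiplication, and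
they agree on generators. Source and target are kept apart because subexpressions may have different
ones; those contribute zero on both sides. -/
lemma ofPres_eval {l r m n : ℕ} {p : ZMod 2} (f : Diagram k (NHSig F) m n p)
    (hm : l + m + r = N) (hn : l + n + r = N) :
    ofPres F N (eval F N f r) = whiskerEnd (NHRel F) l r hm hn f := by
  induction f generalizing l r with
  | gen g =>
    cases g with
    | cross =>
      change l + 2 + r = N at hm
      have h : r < N - 1 := by omega
      exact ((congrArg _ (eval_cross F h)).trans (ofPres_u F _)).trans
        (crossing_eq F ⟨r, h⟩ l hm)
    | dot =>
      change l + 1 + r = N at hm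
      have h : r < N := by omega
      exact ((congrArg _ (eval_dot F h)).trans (ofPres_x F _)).trans (dotOn_eq F ⟨r, h⟩ l hm)
    | token p a =>
      change l + 1 + r = N at hm
      have h : r < N := by omega
      exact ((congrArg _ (eval_token F h a)).trans ((ofPres_tens F _).trans
        (tensHom_single F _ a))).trans (tokenOn_eq F ⟨r, h⟩ a l hm)
  | ident n => rw [eval_ident, map_one, whiskerEnd_ident]
  | @comp l' m n p q f g ihf ihg =>
    by_cases h : l' = m
    · subst h
      rw [eval_comp, map_mul, ihf hm hn, ihg hm hm, whiskerEnd_comp]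
    · rw [eval_comp, eval_eq_zero F g h, mul_zero, map_zero, whiskerEnd_eq_zero]
      exact (Rel.comp_congr (Rel.refl f) (rel_zero_of_ne g h)).trans (Rel.comp_zero f)
  | @tens m n m' n' p q f g ihf ihg =>
    by_cases h : m = n
    · subst h
      obtain rfl : m' = n' := by omega
      have hf : l + m + (r + m') = N := by omega
      have hg : l + m + m' + r = N := by omega
      rw [eval_tens, map_mul, ihf hf hf, ihg hg hg, whiskerEnd_tens]
    · rw [eval_tens, eval_eq_zero F f h, zero_mul, map_zero, whiskerEnd_eq_zero]
      exact (Rel.tens_congr (rel_zero_of_ne f h) (Rel.refl g)).trans (Rel.zero_tens g)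
  | zero m n p => rw [eval_zero, map_zero, whiskerEnd_zero]
  | add f g ihf ihg => rw [eval_add, map_add, ihf hm hn, ihg hm hn, whiskerEnd_add]
  | smul c f ih => rw [eval_smul, map_smul, ih hm hn, whiskerEnd_smul]

lemma ofPres_toPres_toEnd {p : ZMod 2} (f : Diagram k (NHSig F) N N p) :
    ofPres F N (toPres F N (toEnd (NHRel F) f)) = toEnd (NHRel F) f := by
  have h : 0 + N + 0 = N := by omega
  rw [toPres_toEnd, ofPres_eval F f h h]
  -- Here no strands are added, and the strict unit laws remove the two factors `ident 0`.
  refine toEnd_eq ((Rel.cast_left _ _ _ _ _).trans ?_)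
  exact (Rel.tens_id_zero _).trans (Rel.id_tens f)

lemma ofPres_comp_toPres : (ofPres F N).comp (toPres F N) = AlgHom.id k (NilHeckeAlg F N) := by
  refine DirectSum.algHom_ext k _ fun p f => ?_
  obtain ⟨f, rfl⟩ := toHom_surjective _ f
  exact ofPres_toPres_toEnd F f

/-- The isomorphism from the presented algebra to the Frobenius nilHecke algebra. -/
def presEquiv (N : ℕ) : PresAlg F N ≃ₐ[k] NilHeckeAlg F N :=
  AlgEquiv.ofAlgHom (ofPres F N) (toPres F N) (ofPres_comp_toPres F) (toPres_comp_ofPres F)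

lemma ofPres_mem_parity_of_isWord {p : ZMod 2} {y : PresAlg F N} (hy : IsWord F N p y) :
    ofPres F N y ∈ EndAlg.parity (NHRel F) N p := by
  induction hy with
  | one => rw [map_one]; exact SetLike.GradedOne.one_mem
  | tens_mul a y ha _ ih =>
    rw [map_mul, ofPres_tens]
    exact SetLike.mul_mem_graded (tensHom_mem_parity F ha) ih
  | @u_mul q i y _ ih =>
    rw [map_mul, ofPres_u, ← zero_add q]
    exact SetLike.mul_mem_graded (toEnd_mem_parity _) ih
  | x_mul j y _ ih =>
    rw [map_mul, ofPres_x]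
    exact SetLike.mul_mem_graded (toEnd_mem_parity _) ih

/-- One inclusion holds because words in the generators map to homogeneous morphisms. For the other,
the evaluation of a homogeneous expression is a preimage of the right parity. -/
lemma map_parity (p : ZMod 2) :
    (PresAlg.parity F N p).map (presEquiv F N).toLinearMap = EndAlg.parity (NHRel F) N p := by
  refine le_antisymm ?_ ?_
  · rw [PresAlg.parity, Submodule.map_span_le]
    exact fun y hy => ofPres_mem_parity_of_isWord F hy
  · rintro _ ⟨f, rfl⟩
    obtain ⟨f, rfl⟩ := toHom_surjective _ f
    refine ⟨eval F N f 0, eval_mem_parity F f 0, ?_⟩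
    rw [← toPres_toEnd]
    exact ofPres_toPres_toEnd F f

end NilHeckeAlg

end NilHecke

end FrobeniusNilHecke

open FrobeniusNilHecke
theorem mainTheorem5 {k : Type*} [CommRing k] {A : Type*} [Ring A] [Algebra k A]
    (𝒜 : ZMod 2 → Submodule k A) [GradedAlgebra 𝒜]
    {ι : Type*} [Fintype ι] [DecidableEq ι] (F : SymmetricFrobenius 𝒜 ι) (n : ℕ) :
    ∃ e : PresAlg F n ≃ₐ[k] NilHeckeAlg F n,
      (∀ p, (PresAlg.parity F n p).map e.toLinearMap = Diagram.EndAlg.parity (NHRel F) n p) ∧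
      (∀ i, e (PresAlg.u F i) = NilHeckeAlg.crossing F i) ∧
      (∀ j, e (PresAlg.x F j) = NilHeckeAlg.dotOn F j) ∧
      (∀ (j : Fin n) (p : ZMod 2) (a : 𝒜 p),
        e (PresAlg.tens F (SuperTensorPower.single 𝒜 j a)) = NilHeckeAlg.tokenOn F j a) :=
  ⟨NilHeckeAlg.presEquiv F n, NilHeckeAlg.map_parity F, NilHeckeAlg.ofPres_u F,
    NilHeckeAlg.ofPres_x F, fun j _ a =>
      (NilHeckeAlg.ofPres_tens F _).trans (NilHeckeAlg.tensHom_single F j a)⟩
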